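/- All Hilbert spaces are complex and finite-dimensional. For a system $X$ let $\mathcal S(X)$ be the set of positive semidefinite operators of trace one on its Hilbert space. The support of an operator is the orthogonal complement of its kernel, and $L\ll K$ (also written $K\gg L$) means that the support of $L$ is contained in the support of $K$; negative powers and inverses of positive semidefinite operators are taken on their support. For a state $\rho$ and a positive semidefinite $\sigma$ with $\rho\ll\sigma$, the sandwiched Rényi divergence is $$\widetilde D_\alpha(\rho\|\sigma)=\frac1{\alpha-1}\log\operatorname{tr}\Big[\big(\sigma^{\frac{1-\alpha}{2\alpha}}\rho\,\sigma^{\frac{1-\alpha}{2\alpha}}\big)^{\alpha}\Big]\qquad(\alpha\in(0,1)\cup(1,\infty)),$$ and $\widetilde D_1$, $\widetilde D_\infty$ are defined as the corresponding limits; $\widetilde D_\alpha(\rho\|\sigma)=+\infty$ if $\rho\not\ll\sigma$. For $\rho_{AB}\in\mathcal S(AB)$ with marginal $\rho_A=\operatorname{tr}_B\rho_{AB}$ and $\tau_A\ge 0$ with $\tau_A\gg\rho_A$, let $$\widetilde I_\alpha(\rho_{AB}\|\tau_A)=\inf_{\sigma_B\in\mathcal S(B)}\widetilde D_\alpha(\rho_{AB}\|\tau_A\otimes\sigma_B).$$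 **Lemma.** Let $\rho_{AB}\in\mathcal S(AB)$, let $\tau_A\ge0$ satisfy $\tau_A\gg\rho_A$, and let $\alpha,\beta\in[\tfrac12,\infty]$ satisfy $\frac1\alpha+\frac1\beta=2$ (with $\frac1\infty=0$). Then for every purification $\rho_{ABC}$ of $\rho_{AB}$ (a pure state on $ABC$ with $\operatorname{tr}_C\rho_{ABC}=\rho_{AB}$), with $\rho_{AC}=\operatorname{tr}_B\rho_{ABC}$, we have $$\widetilde I_\alpha(\rho_{AB}\|\tau_A)=-\widetilde I_\beta(\rho_{AC}\|\tau_A^{-1}),$$ where the inverse is taken on the support of $\tau_A$. -/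

import Mathlib

open Filter Topology
open scoped ENNReal Kronecker ComplexOrder

/-!
 Finite-dimensional quantum systems.  A system `X` is a finite type and its Hilbert space is
`EuclideanSpace ℂ X`; operators are matrices indexed by `X`; the composite of the systems `X` and
`Y` is `X × Y`, and the tensor product of operators is the Kronecker product.
-/

namespace QInfo

noncomputable section

/-- The set of quantum states (density operators). -/
def states (X : Type*) [Fintype X] : Set (Matrix X X ℂ) :=
  {ρ | ρ.PosSemidef ∧ ρ.trace = 1}

/-- The support of an operator: the orthogonal complement of its kernel. -/
def supp {X : Type*} [Fintype X] [DecidableEq X] (L : Matrix X X ℂ) :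
    Submodule ℂ (EuclideanSpace ℂ X) :=
  (LinearMap.ker (Matrix.toEuclideanLin L))ᗮ

/-- `Dominated L K` is the relation `L ≪ K`: the support of `L` is contained in that of `K`. -/
def Dominated {X : Type*} [Fintype X] [DecidableEq X] (L K : Matrix X X ℂ) : Prop :=
  supp L ≤ supp K

/-- The partial trace over the second system of `X × Y`. -/
def traceRight {X Y : Type*} [Fintype Y] (M : Matrix (X × Y) (X × Y) ℂ) : Matrix X X ℂ :=
  Matrix.of fun x x' => ∑ y, M (x, y) (x', y)

/-- The partial trace over the middle system of `(X × Y) × Z`. -/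
def traceMiddle {X Y Z : Type*} [Fintype Y]
    (M : Matrix ((X × Y) × Z) ((X × Y) × Z) ℂ) : Matrix (X × Z) (X × Z) ℂ :=
  Matrix.of fun p q => ∑ y, M ((p.1, y), p.2) ((q.1, y), q.2)

/-- `ρ` is a purification of the state `ω` of the first system: a pure state
`ρ = |ψ⟩⟨ψ|` of `X × Y` whose marginal on `X` is `ω`. -/
structure IsPurification {X Y : Type*} [Fintype X] [Fintype Y]
    (ρ : Matrix (X × Y) (X × Y) ℂ) (ω : Matrix X X ℂ) : Prop where
  state : ρ ∈ states (X × Y)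
  pure : ∃ ψ : X × Y → ℂ, ρ = Matrix.vecMulVec ψ (star ψ)
  marginal : traceRight ρ = ω

/-- The real power `L ^ s` of a positive semidefinite operator, by functional calculus.
Since `(0 : ℝ) ^ s = 0` for `s ≠ 0`, negative powers are taken on the support of `L`. -/
def opPow {X : Type*} [Fintype X] [DecidableEq X] (L : Matrix X X ℂ) (s : ℝ) : Matrix X X ℂ :=
  cfc (fun x : ℝ => x ^ s) L

/-- The inverse of a Hermitian operator, taken on its support (and zero on its kernel). -/
def suppInv {X : Type*} [Fintype X] [DecidableEq X] (L : Matrix X X ℂ) : Matrix X X ℂ :=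
  cfc (fun x : ℝ => x⁻¹) L

/-- The expression
`(α - 1)⁻¹ log tr [(σ ^ ((1 - α) / (2 α)) ρ σ ^ ((1 - α) / (2 α))) ^ α]`,
which for `ρ ≪ σ` and `α ∈ (0, 1) ∪ (1, ∞)` is the sandwiched Rényi divergence. -/
def sandwichedExpr {X : Type*} [Fintype X] [DecidableEq X] (α : ℝ) (ρ σ : Matrix X X ℂ) : ℝ :=
  (1 / (α - 1)) * Real.log
    (opPow (opPow σ ((1 - α) / (2 * α)) * ρ * opPow σ ((1 - α) / (2 * α))) α).trace.re

open Classical in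
/-- The sandwiched Rényi divergence of order `α ∈ [0, ∞]`: for `α ∈ {0, 1, ∞}` it is the limit of
the divergences of order `a → α`, and it is `+∞` unless `ρ ≪ σ`. -/
def sandwichedDiv {X : Type*} [Fintype X] [DecidableEq X] (α : ℝ≥0∞) (ρ σ : Matrix X X ℂ) :
    EReal :=
  if Dominated ρ σ then
    if α = 0 ∨ α = 1 ∨ α = ∞ then
      ((limUnder (𝓝[≠] α) fun a : ℝ≥0∞ => sandwichedExpr a.toReal ρ σ : ℝ) : EReal)
    else (sandwichedExpr α.toReal ρ σ : EReal)
  else ⊤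

/-- The generalized sandwiched Rényi mutual information: the infimum over all states `σ` of the
second system of the divergence of `ρ` relative to `τ ⊗ σ`. -/
def sandwichedInfo {X Y : Type*} [Fintype X] [DecidableEq X] [Fintype Y] [DecidableEq Y]
    (α : ℝ≥0∞) (ρ : Matrix (X × Y) (X × Y) ℂ) (τ : Matrix X X ℂ) : EReal :=
  ⨅ σ ∈ states Y, sandwichedDiv α ρ (τ ⊗ₖ σ)

end

end QInfo

/-!
# Duality of the sandwiched Rényi mutual information

Let `ψ` be the vector of the purification.  For operators `T`, `V`, `W` of the three systems put
`F(V, W) = ⟨ψ| T ⊗ V ⊗ W |ψ⟩`, where `T = τ ^ (-γ)` and `γ = (α - 1) / α = (1 - β) / β`.  As the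
roles of `α` and `β` can be exchanged together with those of `B` and `C` and of `τ` and its inverse,
assume first `α > 1`, so that `0 < γ ≤ 1`.

The sandwiched operator of `ρ_AB` relative to `τ ⊗ σ` has the nonzero spectrum of the operator
`X = gram ψ T (σ ^ (-γ))` on `C`, and `tr X W = F(σ ^ (-γ), W)` up to a transposition.  Its Schatten
norm of order `α` is the maximum of `tr X W` over the dual ball `{W ≥ 0, tr W ^ (1 / γ) ≤ 1}`
(`isGreatest_dualBall`, `isGreatest_dualBall_one`), whose elements are essentially the `ω ^ γ` for
states `ω` of `C`.  In the same way the quasi-norm of order `β < 1` on the other side is the infimum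
of `tr Y V` over the polar ball `{V > 0, tr V ^ (-1 / γ) ≤ 1}` (`isGLB_polarBall`), whose elements
are essentially the `σ ^ (-γ)`.  Therefore the two informations are `1 / γ` times the logarithm of
`inf sup F` and minus `1 / γ` times that of `sup inf F`, and the claim is a minimax equality
(`sandwichedInfo_duality_of_variational`).  As `F` is bilinear in `(V, W)`, no operator convexity is
needed: both balls are convex, because `W ↦ tr f(W)` is the supremum in Klein's inequality of affine
functions, the dual ball is also compact, and Sion's theorem applies
(`exists_dualBall_forall_polarBall`).  Singular states are approximated by filling in their kernels.

All trace inequalities come from scalar ones: `tr f(X) g(Y)` is a sum of the values `f(x) g(y)` at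
pairs of eigenvalues, with weights independent of `f` and `g` (`exists_weights`).

The order `∞` is a limit, taken by comparing `tr X ^ a` with `‖X‖ ^ a`.  At `α = β = 1` the limit is
the relative entropy (`sandwichedDiv_one`); by Klein's inequality the infimum is attained at the
marginal, and the claim reduces to the equality of the entropies of complementary marginals of a
pure state (`trace_cfc_amp_exch`).
-/

open Matrix

set_option linter.unusedSectionVars false

namespace QInfo


/-! ### Functional calculus of Hermitian matrices -/

section FunctionalCalculus

variable {m n : Type*} [Fintype m] [DecidableEq m] [Fintype n] [DecidableEq n]

theorem cfc_eq_diag {X : Matrix n n ℂ} (hX : X.IsHermitian) (f : ℝ → ℝ) :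
    cfc f X = (hX.eigenvectorUnitary : Matrix n n ℂ) *
      diagonal (fun i => (f (hX.eigenvalues i) : ℂ)) *
        (hX.eigenvectorUnitary : Matrix n n ℂ)ᴴ := by
  rw [hX.cfc_eq, IsHermitian.cfc, Unitary.conjStarAlgAut_apply]
  rfl

theorem eigenvectorUnitary_conjTranspose_mul {X : Matrix n n ℂ} (hX : X.IsHermitian) :
    (hX.eigenvectorUnitary : Matrix n n ℂ)ᴴ * (hX.eigenvectorUnitary : Matrix n n ℂ) = 1 :=
  Unitary.coe_star_mul_self _

theorem eq_diag {X : Matrix n n ℂ} (hX : X.IsHermitian) :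
    X = (hX.eigenvectorUnitary : Matrix n n ℂ) *
      diagonal (fun i => (hX.eigenvalues i : ℂ)) *
        (hX.eigenvectorUnitary : Matrix n n ℂ)ᴴ := by
  have h := cfc_eq_diag hX id
  rwa [cfc_id ℝ X hX.isSelfAdjoint] at h

theorem isHermitian_cfc (f : ℝ → ℝ) (X : Matrix n n ℂ) : (cfc f X).IsHermitian :=
  (cfc_predicate f X : IsSelfAdjoint (cfc f X))

theorem cfc_congr_eigenvalues {X : Matrix n n ℂ} (hX : X.IsHermitian) {f g : ℝ → ℝ}
    (h : ∀ i, f (hX.eigenvalues i) = g (hX.eigenvalues i)) : cfc f X = cfc g X := by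
  rw [cfc_eq_diag hX, cfc_eq_diag hX]
  simp only [h]

theorem cfc_congr_nonneg {X : Matrix n n ℂ} (hX : X.PosSemidef) {f g : ℝ → ℝ}
    (h : ∀ x, 0 ≤ x → f x = g x) : cfc f X = cfc g X :=
  cfc_congr_eigenvalues hX.1 fun i => h _ (hX.eigenvalues_nonneg i)

theorem cfc_mul_cfc {X : Matrix n n ℂ} (hX : X.IsHermitian) (f g : ℝ → ℝ) :
    cfc f X * cfc g X = cfc (fun x => f x * g x) X := by
  simp only [cfc_eq_diag hX]
  rw [show ∀ U D E : Matrix n n ℂ, U * D * Uᴴ * (U * E * Uᴴ) = U * (D * (Uᴴ * U) * E) * Uᴴ by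
    intro U D E; simp only [Matrix.mul_assoc], eigenvectorUnitary_conjTranspose_mul, Matrix.mul_one,
    diagonal_mul_diagonal]
  simp

theorem cfc_comp_cfc {X : Matrix n n ℂ} (hX : X.IsHermitian) (f g : ℝ → ℝ) :
    cfc f (cfc g X) = cfc (fun x => f (g x)) X := by
  have := X.finite_real_spectrum (𝕜 := ℂ)
  exact (cfc_comp' f g X (((this.image g).continuousOn f))
    (this.continuousOn g) hX.isSelfAdjoint).symm

theorem posSemidef_cfc {X : Matrix n n ℂ} (hX : X.IsHermitian) {f : ℝ → ℝ}
    (h : ∀ i, 0 ≤ f (hX.eigenvalues i)) : (cfc f X).PosSemidef := by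
  rw [cfc_eq_diag hX]
  refine PosSemidef.mul_mul_conjTranspose_same (PosSemidef.diagonal ?_) _
  intro i
  simpa using h i

theorem posDef_cfc {X : Matrix n n ℂ} (hX : X.IsHermitian) {f : ℝ → ℝ}
    (h : ∀ i, 0 < f (hX.eigenvalues i)) : (cfc f X).PosDef := by
  have h1 := posSemidef_cfc hX fun i => (h i).le
  have h2 : cfc f X * cfc (fun x => (f x)⁻¹) X = 1 := by
    rw [cfc_mul_cfc hX, cfc_congr_eigenvalues hX (g := fun _ => 1), cfc_const_one ℝ X]
    intro i
    exact mul_inv_cancel₀ (h i).ne'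
  exact h1.posDef_iff_isUnit.2 (IsUnit.of_mul_eq_one _ h2)

theorem trace_cfc {X : Matrix n n ℂ} (hX : X.IsHermitian) (f : ℝ → ℝ) :
    (cfc f X).trace.re = ∑ i, f (hX.eigenvalues i) := by
  rw [cfc_eq_diag hX, trace_mul_cycle, eigenvectorUnitary_conjTranspose_mul, Matrix.one_mul,
    trace_diagonal]
  simp

/-- On matrices, where spectra are finite, the functional calculus of two given Hermitian matrices
is given by one polynomial. -/
theorem exists_polynomial_cfc {X : Matrix m m ℂ} {Y : Matrix n n ℂ} (hX : X.IsHermitian)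
    (hY : Y.IsHermitian) (f : ℝ → ℝ) : ∃ p : Polynomial ℝ,
      cfc f X = Polynomial.aeval X p ∧ cfc f Y = Polynomial.aeval Y p := by
  classical
  let s : Finset ℝ := Finset.univ.image hX.eigenvalues ∪ Finset.univ.image hY.eigenvalues
  let p := Lagrange.interpolate s id f
  have hp : ∀ x ∈ s, p.eval x = f x := fun x hx =>
    Lagrange.eval_interpolate_at_node f (Set.injOn_id _) hx
  refine ⟨p, ?_, ?_⟩
  · rw [← cfc_polynomial p X hX.isSelfAdjoint]
    exact cfc_congr_eigenvalues hX fun i => (hp _ (by simp [s])).symm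
  · rw [← cfc_polynomial p Y hY.isSelfAdjoint]
    exact cfc_congr_eigenvalues hY fun i => (hp _ (by simp [s])).symm

theorem aeval_mul_comm_of_mul_comm {X : Matrix m m ℂ} {Y : Matrix n n ℂ} {K : Matrix m n ℂ}
    (h : X * K = K * Y) (p : Polynomial ℝ) :
    Polynomial.aeval X p * K = K * Polynomial.aeval Y p := by
  induction p using Polynomial.induction_on' with
  | add p q hp hq => simp only [map_add, Matrix.add_mul, Matrix.mul_add, hp, hq]
  | monomial k r =>
    have hk : X ^ k * K = K * Y ^ k := by
      induction k with
      | zero => simp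
      | succ k ih => rw [pow_succ, Matrix.mul_assoc, h, ← Matrix.mul_assoc, ih, Matrix.mul_assoc,
          ← pow_succ]
    rw [Polynomial.aeval_monomial, Polynomial.aeval_monomial, ← Algebra.smul_def,
      ← Algebra.smul_def, Matrix.smul_mul, Matrix.mul_smul, hk]

/-- An operator that intertwines two Hermitian matrices intertwines all functions of them. -/
theorem cfc_mul_comm_of_mul_comm {X : Matrix m m ℂ} {Y : Matrix n n ℂ} (hX : X.IsHermitian)
    (hY : Y.IsHermitian) {K : Matrix m n ℂ} (h : X * K = K * Y) (f : ℝ → ℝ) :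
    cfc f X * K = K * cfc f Y := by
  obtain ⟨p, h1, h2⟩ := exists_polynomial_cfc hX hY f
  rw [h1, h2, aeval_mul_comm_of_mul_comm h]

theorem cfc_eq_cfc_div_mul {X : Matrix n n ℂ} (hX : X.IsHermitian) {f : ℝ → ℝ} (hf : f 0 = 0) :
    cfc f X = cfc (fun x => f x / x) X * X := by
  conv_rhs => rw [← cfc_id' ℝ X hX.isSelfAdjoint]
  rw [cfc_comp_cfc hX, cfc_mul_cfc hX]
  refine cfc_congr_eigenvalues hX fun i => ?_
  rcases eq_or_ne (hX.eigenvalues i) 0 with h | h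
  · simp [hf, h]
  · field_simp

/-- `K Kᴴ` and `Kᴴ K` have the same nonzero spectrum. -/
theorem trace_cfc_mul_conjTranspose (K : Matrix m n ℂ) {f : ℝ → ℝ} (hf : f 0 = 0) :
    (cfc f (K * Kᴴ)).trace = (cfc f (Kᴴ * K)).trace := by
  have hX := isHermitian_mul_conjTranspose_self K
  have hY := isHermitian_conjTranspose_mul_self K
  rw [cfc_eq_cfc_div_mul hX hf, cfc_eq_cfc_div_mul hY hf, ← Matrix.mul_assoc,
    cfc_mul_comm_of_mul_comm hX hY (Matrix.mul_assoc K Kᴴ K), trace_mul_cycle, trace_mul_comm]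

theorem cfc_transpose {X : Matrix n n ℂ} (hX : X.IsHermitian) (f : ℝ → ℝ) :
    cfc f Xᵀ = (cfc f X)ᵀ := by
  obtain ⟨p, h1, h2⟩ := exists_polynomial_cfc hX hX.transpose f
  rw [h1, h2]
  clear h1 h2
  induction p using Polynomial.induction_on' with
  | add p q hp hq => simp only [map_add, transpose_add, hp, hq]
  | monomial k r =>
    rw [Polynomial.aeval_monomial, Polynomial.aeval_monomial, ← Algebra.smul_def,
      ← Algebra.smul_def, transpose_smul, transpose_pow]

theorem cfc_diagonal (d : n → ℝ) (f : ℝ → ℝ) :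
    cfc f (diagonal fun i => (d i : ℂ)) = diagonal fun i => (f (d i) : ℂ) := by
  have hD : (diagonal fun i => (d i : ℂ)).IsHermitian :=
    isHermitian_diagonal_of_self_adjoint _ (by ext; simp)
  have key : ∀ j, cfc f (diagonal fun i => (d i : ℂ)) * single j j (1 : ℂ) =
      single j j (1 : ℂ) * diagonal fun _ : n => (f (d j) : ℂ) := by
    intro j
    have h := cfc_mul_comm_of_mul_comm hD (Y := algebraMap ℝ (Matrix n n ℂ) (d j))
      (IsSelfAdjoint.algebraMap _ (IsSelfAdjoint.all _)) (K := single j j (1 : ℂ)) (by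
        ext a b
        rw [diagonal_mul, Matrix.algebraMap_eq_diagonal, mul_diagonal, single_apply]
        by_cases hab : j = a ∧ j = b
        · simp [hab]
        · simp [hab]) f
    rw [h, cfc_algebraMap]
    rfl
  ext a b
  have := congrFun (congrFun (key b) a) b
  simp [Matrix.mul_apply, single_apply, diagonal_apply] at this
  rw [this]
  by_cases h : a = b
  · subst h; simp
  · simp [h, Ne.symm h]

theorem cfc_unitary_conj {X U : Matrix n n ℂ} (hX : X.IsHermitian) (hU : Uᴴ * U = 1)
    (f : ℝ → ℝ) : cfc f (U * X * Uᴴ) = U * cfc f X * Uᴴ := by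
  have h := cfc_mul_comm_of_mul_comm (isHermitian_mul_mul_conjTranspose U hX) hX (K := U)
    (by rw [Matrix.mul_assoc _ Uᴴ, hU, Matrix.mul_one]) f
  rw [← h, Matrix.mul_assoc _ U, mul_eq_one_comm.1 hU, Matrix.mul_one]

theorem kronecker_eq_diag {X : Matrix m m ℂ} {Y : Matrix n n ℂ} (hX : X.IsHermitian)
    (hY : Y.IsHermitian) (f g : ℝ → ℝ) : cfc f X ⊗ₖ cfc g Y =
      ((hX.eigenvectorUnitary : Matrix m m ℂ) ⊗ₖ (hY.eigenvectorUnitary : Matrix n n ℂ)) *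
        diagonal (fun i => ((f (hX.eigenvalues i.1) * g (hY.eigenvalues i.2) : ℝ) : ℂ)) *
      ((hX.eigenvectorUnitary : Matrix m m ℂ) ⊗ₖ (hY.eigenvectorUnitary : Matrix n n ℂ))ᴴ := by
  rw [cfc_eq_diag hX, cfc_eq_diag hY, mul_kronecker_mul, mul_kronecker_mul,
    diagonal_kronecker_diagonal, conjTranspose_kronecker]
  simp

/-- The functional calculus of a tensor product, for a function of `x y` that is a sum of two
products of a function of `x` and a function of `y`. -/
theorem cfc_kronecker_add {X : Matrix m m ℂ} {Y : Matrix n n ℂ} (hX : X.IsHermitian)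
    (hY : Y.IsHermitian) {f g₁ h₁ g₂ h₂ : ℝ → ℝ}
    (hf : ∀ i j, f (hX.eigenvalues i * hY.eigenvalues j) =
      g₁ (hX.eigenvalues i) * h₁ (hY.eigenvalues j) +
        g₂ (hX.eigenvalues i) * h₂ (hY.eigenvalues j)) :
    cfc f (X ⊗ₖ Y) = cfc g₁ X ⊗ₖ cfc h₁ Y + cfc g₂ X ⊗ₖ cfc h₂ Y := by
  rw [kronecker_eq_diag hX hY, kronecker_eq_diag hX hY, ← Matrix.add_mul, ← Matrix.mul_add,
    diagonal_add]
  conv_lhs => rw [← cfc_id ℝ X hX.isSelfAdjoint, ← cfc_id ℝ Y hY.isSelfAdjoint,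
    kronecker_eq_diag hX hY]
  rw [cfc_unitary_conj, cfc_diagonal]
  · simp only [id_eq, hf]
    push_cast
    rfl
  · exact isHermitian_diagonal_of_self_adjoint _ (by ext; simp)
  · rw [conjTranspose_kronecker, ← mul_kronecker_mul, eigenvectorUnitary_conjTranspose_mul,
      eigenvectorUnitary_conjTranspose_mul, one_kronecker_one]

theorem cfc_kronecker {X : Matrix m m ℂ} {Y : Matrix n n ℂ} (hX : X.IsHermitian)
    (hY : Y.IsHermitian) {f g h : ℝ → ℝ}
    (hf : ∀ i j, f (hX.eigenvalues i * hY.eigenvalues j) =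
      g (hX.eigenvalues i) * h (hY.eigenvalues j)) :
    cfc f (X ⊗ₖ Y) = cfc g X ⊗ₖ cfc h Y := by
  rw [cfc_kronecker_add hX hY (g₁ := g) (h₁ := h) (g₂ := fun _ => 0) (h₂ := fun _ => 0)
    (by simpa using hf)]
  simp

/-- The traces `tr f(X) g(Y)` are the averages of `f(x) g(y)` over the pairs of eigenvalues, with
nonnegative weights that do not depend on `f` and `g`.  Scalar inequalities in two variables thus
turn into trace inequalities. -/
theorem exists_weights {X Y : Matrix n n ℂ} (hX : X.IsHermitian) (hY : Y.IsHermitian) :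
    ∃ p : n → n → ℝ, (∀ i j, 0 ≤ p i j) ∧ ∀ f g : ℝ → ℝ,
      (cfc f X * cfc g Y).trace.re =
        ∑ i, ∑ j, p i j * (f (hX.eigenvalues i) * g (hY.eigenvalues j)) := by
  set U := (hX.eigenvectorUnitary : Matrix n n ℂ)
  set V := (hY.eigenvectorUnitary : Matrix n n ℂ)
  refine ⟨fun i j => Complex.normSq ((Uᴴ * V) i j), fun i j => Complex.normSq_nonneg _,
    fun f g => ?_⟩
  rw [cfc_eq_diag hX, cfc_eq_diag hY]
  rw [show ∀ D E : Matrix n n ℂ, (U * D * Uᴴ * (V * E * Vᴴ)).trace =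
      ((D * (Uᴴ * V)) * (E * (Uᴴ * V)ᴴ)).trace by
    intro D E
    rw [conjTranspose_mul, conjTranspose_conjTranspose]
    simp only [Matrix.mul_assoc]
    rw [trace_mul_comm]
    simp only [Matrix.mul_assoc]]
  rw [trace, Complex.re_sum]
  refine Finset.sum_congr rfl fun i _ => ?_
  rw [diag_apply, Matrix.mul_apply, Complex.re_sum]
  refine Finset.sum_congr rfl fun j _ => ?_
  rw [diagonal_mul, diagonal_mul, conjTranspose_apply]
  rw [show ∀ a b c : ℂ, a * b * (c * star b) = (a * c) * (b * star b) by intros; ring]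
  rw [show ∀ b : ℂ, b * star b = (Complex.normSq b : ℂ) from Complex.mul_conj]
  norm_cast
  ring

end FunctionalCalculus


/-! ### Trace inequalities from scalar inequalities -/

section TraceInequalities

variable {n : Type*} [Fintype n] [DecidableEq n]

/-- A scalar inequality with separated variables holds under the trace. -/
theorem trace_mul_le_of_forall {X Y : Matrix n n ℂ} (hX : X.IsHermitian) (hY : Y.IsHermitian)
    {f₁ g₁ f₂ g₂ f₃ g₃ : ℝ → ℝ}
    (h : ∀ i j, f₁ (hX.eigenvalues i) * g₁ (hY.eigenvalues j) ≤
      f₂ (hX.eigenvalues i) * g₂ (hY.eigenvalues j) +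
        f₃ (hX.eigenvalues i) * g₃ (hY.eigenvalues j)) :
    (cfc f₁ X * cfc g₁ Y).trace.re ≤
      (cfc f₂ X * cfc g₂ Y).trace.re + (cfc f₃ X * cfc g₃ Y).trace.re := by
  obtain ⟨p, hp, hpt⟩ := exists_weights hX hY
  simp only [hpt, ← Finset.sum_add_distrib, ← mul_add]
  exact Finset.sum_le_sum fun i _ => Finset.sum_le_sum fun j _ =>
    mul_le_mul_of_nonneg_left (h i j) (hp i j)

/-- Klein's inequality, for a function `f` whose graph lies above its tangents of slopes `f'`. -/
theorem trace_klein {X Z : Matrix n n ℂ} (hX : X.IsHermitian) (hZ : Z.IsHermitian)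
    {f f' : ℝ → ℝ} (h : ∀ i j, hX.eigenvalues i * f' (hZ.eigenvalues j) ≤
      f (hX.eigenvalues i) + (hZ.eigenvalues j * f' (hZ.eigenvalues j) - f (hZ.eigenvalues j))) :
    (X * cfc f' Z).trace.re ≤
      (cfc f X).trace.re + (cfc (fun z => z * f' z - f z) Z).trace.re := by
  have := trace_mul_le_of_forall hX hZ (f₁ := id) (g₁ := f') (f₂ := f) (g₂ := fun _ => 1)
    (f₃ := fun _ => 1) (g₃ := fun z => z * f' z - f z) (by simpa using h)
  rwa [cfc_id ℝ X hX.isSelfAdjoint, cfc_const_one ℝ X hX.isSelfAdjoint,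
    cfc_const_one ℝ Z hZ.isSelfAdjoint, Matrix.mul_one, Matrix.one_mul] at this

theorem trace_mul_cfc_self {X : Matrix n n ℂ} (hX : X.IsHermitian) (f : ℝ → ℝ) :
    (X * cfc f X).trace.re = ∑ i, hX.eigenvalues i * f (hX.eigenvalues i) := by
  conv_lhs => rw [← cfc_id ℝ X hX.isSelfAdjoint]
  rw [cfc_comp_cfc hX, cfc_mul_cfc hX, trace_cfc hX]
  rfl

theorem trace_cfc_tangent {X : Matrix n n ℂ} (hX : X.IsHermitian) (f f' : ℝ → ℝ) :
    (cfc (fun z => z * f' z - f z) X).trace.re =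
      (X * cfc f' X).trace.re - (cfc f X).trace.re := by
  rw [trace_mul_cfc_self hX, trace_cfc hX, trace_cfc hX, Finset.sum_sub_distrib]

/-- Convexity of `X ↦ tr f(X)`: the supremum in Klein's inequality is over affine functions. -/
theorem trace_cfc_convex_comb_le {X Y : Matrix n n ℂ} (hX : X.IsHermitian) (hY : Y.IsHermitian)
    {a b : ℝ} (ha : 0 ≤ a) (hb : 0 ≤ b) (hab : a + b = 1) {f f' : ℝ → ℝ} {s : Set ℝ}
    (h : ∀ x ∈ s, ∀ z ∈ s, x * f' z ≤ f x + (z * f' z - f z))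
    (hXs : ∀ i, hX.eigenvalues i ∈ s) (hYs : ∀ i, hY.eigenvalues i ∈ s)
    (hZ : (a • X + b • Y).IsHermitian) (hZs : ∀ i, hZ.eigenvalues i ∈ s) :
    (cfc f (a • X + b • Y)).trace.re ≤ a * (cfc f X).trace.re + b * (cfc f Y).trace.re := by
  have h1 := trace_klein hX hZ fun i j => h _ (hXs i) _ (hZs j)
  have h2 := trace_klein hY hZ fun i j => h _ (hYs i) _ (hZs j)
  rw [trace_cfc_tangent hZ] at h1 h2
  have h3 : ∀ M, ((a • X + b • Y) * M).trace.re = a * (X * M).trace.re + b * (Y * M).trace.re := by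
    intro M
    simp [Matrix.add_mul]
  rw [h3] at h1 h2
  have h4 := mul_le_mul_of_nonneg_left h1 ha
  have h5 := mul_le_mul_of_nonneg_left h2 hb
  set T := a * (X * cfc f' (a • X + b • Y)).trace.re + b * (Y * cfc f' (a • X + b • Y)).trace.re -
    (cfc f (a • X + b • Y)).trace.re with hT
  have h6 : a * T + b * T = T := by rw [← add_mul, hab, one_mul]
  linarith

/-- The graph of `x ↦ x ^ p` lies above its tangents, for `p ≥ 1`. -/
theorem mul_rpow_le_tangent {p x z : ℝ} (hp : 1 ≤ p) (hx : 0 ≤ x) (hz : 0 ≤ z) :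
    x * (p * z ^ (p - 1)) ≤ x ^ p + (z * (p * z ^ (p - 1)) - z ^ p) := by
  have hp0 : 0 < p := by linarith
  have h := Real.geom_mean_le_arith_mean2_weighted (w₁ := 1 / p) (w₂ := 1 - 1 / p)
    (p₁ := x ^ p) (p₂ := z ^ p) (by positivity)
    (by rw [sub_nonneg, div_le_one hp0]; exact hp) (by positivity) (by positivity) (by ring)
  rw [← Real.rpow_mul hx, ← Real.rpow_mul hz, show p * (1 / p) = 1 by field_simp, Real.rpow_one,
    show p * (1 - 1 / p) = p - 1 by field_simp] at h
  have hzp : z * z ^ (p - 1) = z ^ p := by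
    rcases hz.eq_or_lt with rfl | hz'
    · rw [zero_mul, Real.zero_rpow hp0.ne']
    · rw [Real.rpow_sub_one hz'.ne']; field_simp
  have h2 : z * (p * z ^ (p - 1)) = p * z ^ p := by rw [← hzp]; ring
  rw [h2]
  have h3 := mul_le_mul_of_nonneg_left h hp0.le
  have h4 : p * (1 / p * x ^ p + (1 - 1 / p) * z ^ p) = x ^ p + (p * z ^ p - z ^ p) := by
    field_simp
  linarith

/-- The graph of `x ↦ x ^ (-q)` lies above its tangents. -/
theorem rpow_neg_tangent {q x z : ℝ} (hq : 0 < q) (hx : 0 < x) (hz : 0 < z) :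
    x * (-q * z ^ (-q - 1)) ≤ x ^ (-q) + (z * (-q * z ^ (-q - 1)) - z ^ (-q)) := by
  have hq1 : 0 < 1 + q := by linarith
  have h := Real.geom_mean_le_arith_mean2_weighted (w₁ := 1 / (1 + q)) (w₂ := q / (1 + q))
    (p₁ := x ^ (-q)) (p₂ := x * z ^ (-q - 1)) (by positivity) (by positivity) (by positivity)
    (by positivity) (by field_simp)
  rw [Real.mul_rpow hx.le (by positivity), ← Real.rpow_mul hx.le, ← Real.rpow_mul hz.le,
    ← mul_assoc, ← Real.rpow_add hx, show -q * (1 / (1 + q)) + q / (1 + q) = 0 by ring,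
    Real.rpow_zero, one_mul, show (-q - 1) * (q / (1 + q)) = -q by field_simp; ring] at h
  have h2 : z * (-q * z ^ (-q - 1)) = -q * z ^ (-q) := by
    rw [Real.rpow_sub_one hz.ne']; field_simp
  rw [h2]
  have h3 := mul_le_mul_of_nonneg_left h hq1.le
  have h4 : (1 + q) * (1 / (1 + q) * x ^ (-q) + q / (1 + q) * (x * z ^ (-q - 1))) =
      x ^ (-q) + q * (x * z ^ (-q - 1)) := by
    field_simp
  linarith

/-- Young's inequality for the exponents `1 / (1 - γ)` and `1 / γ`, with a free scale `r`. -/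
theorem young_div {γ x w r : ℝ} (hγ : 0 < γ) (hγ1 : γ < 1) (hx : 0 ≤ x) (hw : 0 ≤ w)
    (hr : 0 < r) : x * w ≤ r * (1 - γ) * (x / r) ^ (1 / (1 - γ)) + r * γ * w ^ (1 / γ) := by
  have h1 : 0 < 1 - γ := by linarith
  have h := Real.geom_mean_le_arith_mean2_weighted (w₁ := 1 - γ) (w₂ := γ)
    (p₁ := (x / r) ^ (1 / (1 - γ))) (p₂ := w ^ (1 / γ)) h1.le hγ.le (by positivity)
    (by positivity) (by ring)
  rw [← Real.rpow_mul (by positivity), ← Real.rpow_mul hw, one_div_mul_cancel h1.ne',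
    one_div_mul_cancel hγ.ne', Real.rpow_one, Real.rpow_one] at h
  have h2 := mul_le_mul_of_nonneg_left h hr.le
  have h3 : r * (x / r * w) = x * w := by field_simp
  linarith

/-- The reverse of Young's inequality, for the exponents `1 / (1 + γ)` and `-1 / γ`, with a free
scale `s`. -/
theorem reverse_young {γ y v s : ℝ} (hγ : 0 < γ) (hy : 0 ≤ y) (hv : 0 < v) (hs : 0 < s) :
    (1 + γ) * y ^ (1 / (1 + γ)) ≤ s * (y * v) + γ * s ^ (-(1 / γ)) * v ^ (-(1 / γ)) := by
  have h1 : 0 < 1 + γ := by linarith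
  have h := Real.geom_mean_le_arith_mean2_weighted (w₁ := 1 / (1 + γ)) (w₂ := γ / (1 + γ))
    (p₁ := s * (y * v)) (p₂ := (s * v) ^ (-(1 / γ))) (by positivity) (by positivity)
    (by positivity) (by positivity) (by field_simp)
  have h2 : s * (y * v) = y * (s * v) := by ring
  rw [h2, Real.mul_rpow hy (by positivity), ← Real.rpow_mul (by positivity), mul_assoc,
    ← Real.rpow_add (by positivity),
    show 1 / (1 + γ) + -(1 / γ) * (γ / (1 + γ)) = 0 by field_simp; ring, Real.rpow_zero,
    mul_one] at h
  have h3 := mul_le_mul_of_nonneg_left h h1.le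
  rw [Real.mul_rpow hs.le hv.le] at h3
  have h4 : (1 + γ) * (1 / (1 + γ) * (y * (s * v)) +
      γ / (1 + γ) * (s ^ (-(1 / γ)) * v ^ (-(1 / γ)))) =
      s * (y * v) + γ * s ^ (-(1 / γ)) * v ^ (-(1 / γ)) := by
    field_simp
  linarith

end TraceInequalities


/-! ### The dual ball and the polar ball -/

section Balls

variable {n : Type*} [Fintype n] [DecidableEq n]

/-- The positive part of the unit ball of the Schatten norm of exponent `1 / γ`. -/
def dualBall (n : Type*) [Fintype n] [DecidableEq n] (γ : ℝ) : Set (Matrix n n ℂ) :=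
  {W | W.PosSemidef ∧ (opPow W (1 / γ)).trace.re ≤ 1}

/-- The positive definite operators `V` with `tr V ^ (-1 / γ) ≤ 1`; they are the multiples, by
factors at least `1`, of the powers `σ ^ (-γ)` of positive definite states `σ`. -/
def polarBall (n : Type*) [Fintype n] [DecidableEq n] (γ : ℝ) : Set (Matrix n n ℂ) :=
  {V | V.PosDef ∧ (opPow V (-(1 / γ))).trace.re ≤ 1}

theorem transpose_mem_dualBall {γ : ℝ} {W : Matrix n n ℂ} (hW : W ∈ dualBall n γ) :
    Wᵀ ∈ dualBall n γ := by
  refine ⟨hW.1.transpose, ?_⟩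
  rw [opPow, cfc_transpose hW.1.1, trace_transpose]
  exact hW.2

theorem transpose_mem_polarBall {γ : ℝ} {V : Matrix n n ℂ} (hV : V ∈ polarBall n γ) :
    Vᵀ ∈ polarBall n γ := by
  refine ⟨hV.1.transpose, ?_⟩
  rw [opPow, cfc_transpose hV.1.1, trace_transpose]
  exact hV.2

theorem posSemidef_comb {n : Type*} {X Y : Matrix n n ℂ} (hX : X.PosSemidef) (hY : Y.PosSemidef)
    {a b : ℝ}
    (ha : 0 ≤ a) (hb : 0 ≤ b) : (a • X + b • Y).PosSemidef :=
  (hX.smul ha).add (hY.smul hb)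

theorem convex_dualBall {γ : ℝ} (hγ : 0 < γ) (hγ1 : γ ≤ 1) : Convex ℝ (dualBall n γ) := by
  intro X hX Y hY a b ha hb hab
  have hZ := posSemidef_comb hX.1 hY.1 ha hb
  refine ⟨hZ, ?_⟩
  have h := trace_cfc_convex_comb_le hX.1.1 hY.1.1 ha hb hab (s := Set.Ici 0)
    (fun x hx z hz => mul_rpow_le_tangent (p := 1 / γ) (by rwa [le_div_iff₀ hγ, one_mul]) hx hz)
    hX.1.eigenvalues_nonneg hY.1.eigenvalues_nonneg hZ.1 hZ.eigenvalues_nonneg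
  exact h.trans (by
    have h1 := mul_le_mul_of_nonneg_left hX.2 ha
    have h2 := mul_le_mul_of_nonneg_left hY.2 hb
    simp only [opPow] at h1 h2
    linarith)

theorem convex_polarBall {γ : ℝ} (hγ : 0 < γ) : Convex ℝ (polarBall n γ) := by
  intro X hX Y hY a b ha hb hab
  have hZ : (a • X + b • Y).PosDef := by
    rcases ha.eq_or_lt with rfl | ha'
    · obtain rfl : b = 1 := by linarith
      simpa using hY.1
    · exact (hX.1.smul ha').add_posSemidef (hY.1.posSemidef.smul hb)
  refine ⟨hZ, ?_⟩
  have h := trace_cfc_convex_comb_le hX.1.1 hY.1.1 ha hb hab (s := Set.Ioi 0)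
    (fun x hx z hz => rpow_neg_tangent (q := 1 / γ) (by positivity) hx hz)
    hX.1.eigenvalues_pos hY.1.eigenvalues_pos hZ.1 hZ.eigenvalues_pos
  exact h.trans (by
    have h1 := mul_le_mul_of_nonneg_left hX.2 ha
    have h2 := mul_le_mul_of_nonneg_left hY.2 hb
    simp only [opPow] at h1 h2
    linarith)

theorem isClosed_posSemidef {n : Type*} [Fintype n] : IsClosed {W : Matrix n n ℂ | W.PosSemidef} := by
  have : {W : Matrix n n ℂ | W.PosSemidef} =
      {W | Wᴴ = W} ∩ ⋂ x : n → ℂ, {W | 0 ≤ star x ⬝ᵥ (W *ᵥ x)} := by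
    ext W
    simp [posSemidef_iff_dotProduct_mulVec, IsHermitian]
  rw [this]
  refine (isClosed_eq (by fun_prop) (by fun_prop)).inter (isClosed_iInter fun x => ?_)
  exact isClosed_le continuous_const (by fun_prop)

theorem isClosed_dualBall {γ : ℝ} (hγ : 0 < γ) (hγ1 : γ ≤ 1) : IsClosed (dualBall n γ) := by
  set p := 1 / γ
  -- By Klein's inequality the trace condition is an intersection of half-spaces.
  have : dualBall n γ = {W | W.PosSemidef} ∩ ⋂ Z ∈ {Z : Matrix n n ℂ | Z.PosSemidef},
      {W | (W * cfc (fun z => p * z ^ (p - 1)) Z).trace.re ≤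
        1 + (cfc (fun z => z * (p * z ^ (p - 1)) - z ^ p) Z).trace.re} := by
    ext W
    simp only [dualBall, Set.mem_inter_iff, Set.mem_iInter, Set.mem_ofPred_eq]
    refine and_congr_right fun hW => ⟨fun h Z hZ => ?_, fun h => ?_⟩
    · have h2 := trace_klein hW.1 hZ.1 (f := fun x => x ^ p) (f' := fun z => p * z ^ (p - 1))
        fun i j => mul_rpow_le_tangent (by rwa [le_div_iff₀ hγ, one_mul])
          (hW.eigenvalues_nonneg i) (hZ.eigenvalues_nonneg j)
      simp only [opPow] at h
      linarith
    · have h2 := h W hW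
      rw [trace_cfc_tangent hW.1] at h2
      simp only [opPow]
      linarith
  rw [this]
  refine isClosed_posSemidef.inter (isClosed_biInter fun Z _ => isClosed_le ?_ continuous_const)
  fun_prop

theorem eigenvalues_le_one_of_mem_dualBall {γ : ℝ} (hγ : 0 < γ) {W : Matrix n n ℂ}
    (hW : W ∈ dualBall n γ) (i : n) : hW.1.1.eigenvalues i ≤ 1 := by
  have h := hW.2
  rw [opPow, trace_cfc hW.1.1] at h
  have h2 : hW.1.1.eigenvalues i ^ (1 / γ) ≤ 1 :=
    (Finset.single_le_sum (f := fun i => hW.1.1.eigenvalues i ^ (1 / γ))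
      (fun j _ => Real.rpow_nonneg (hW.1.eigenvalues_nonneg j) _) (Finset.mem_univ i)).trans h
  by_contra! hc
  exact absurd h2 (not_le.2 (Real.one_lt_rpow hc (by positivity)))

theorem isCompact_dualBall {γ : ℝ} (hγ : 0 < γ) (hγ1 : γ ≤ 1) : IsCompact (dualBall n γ) := by
  have hc : IsCompact {W : Matrix n n ℂ | ∀ i, W i ∈ {w : n → ℂ | ∀ j, w j ∈
      Metric.closedBall (0 : ℂ) (Fintype.card n)}} :=
    isCompact_pi_infinite fun _ => isCompact_pi_infinite fun _ => isCompact_closedBall _ _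
  refine hc.of_isClosed_subset (isClosed_dualBall hγ hγ1) fun W hW i j => ?_
  have hH := hW.1.1
  -- The square of an entry is at most `tr W ^ 2`, and the eigenvalues of `W` are at most `1`.
  have h1 : ∑ k, ∑ l, Complex.normSq (W k l) = (W * W).trace.re := by
    rw [trace, Complex.re_sum]
    refine Finset.sum_congr rfl fun k _ => ?_
    rw [diag_apply, Matrix.mul_apply, Complex.re_sum]
    refine Finset.sum_congr rfl fun l _ => ?_
    rw [← hH.apply l k, show ∀ b : ℂ, b * star b = (Complex.normSq b : ℂ) from Complex.mul_conj]
    simp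
  have h2 : (W * W).trace.re ≤ Fintype.card n := by
    conv_lhs => rw [← cfc_id ℝ W hH.isSelfAdjoint]
    rw [cfc_mul_cfc hH, trace_cfc hH]
    calc ∑ i, id (hH.eigenvalues i) * id (hH.eigenvalues i) ≤ ∑ i : n, (1 : ℝ) := by
          refine Finset.sum_le_sum fun i _ => ?_
          have := eigenvalues_le_one_of_mem_dualBall hγ hW i
          have h0 := hW.1.eigenvalues_nonneg i
          exact mul_le_one₀ this h0 this
      _ = Fintype.card n := by simp
  have h3 : Complex.normSq (W i j) ≤ Fintype.card n := by
    rw [← h1] at h2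
    refine le_trans ?_ h2
    refine le_trans ?_ (Finset.single_le_sum (f := fun k => ∑ l, Complex.normSq (W k l))
      (fun k _ => Finset.sum_nonneg fun l _ => Complex.normSq_nonneg _) (Finset.mem_univ i))
    exact Finset.single_le_sum (f := fun l => Complex.normSq (W i l))
      (fun l _ => Complex.normSq_nonneg _) (Finset.mem_univ j)
  have h4 : (1 : ℝ) ≤ Fintype.card n := by
    exact_mod_cast Fintype.card_pos_iff.2 ⟨i⟩
  rw [mem_closedBall_zero_iff]
  rw [Complex.normSq_eq_norm_sq] at h3
  nlinarith [norm_nonneg (W i j)]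

/-- `‖X‖_α = max tr X W` over the dual ball, for finite `α = 1 / (1 - γ)`. -/
theorem isGreatest_dualBall {γ : ℝ} (hγ : 0 < γ) (hγ1 : γ < 1) {X : Matrix n n ℂ}
    (hX : X.PosSemidef) (ht : 0 < (opPow X (1 / (1 - γ))).trace.re) :
    IsGreatest {r | ∃ W ∈ dualBall n γ, r = (X * W).trace.re}
      ((opPow X (1 / (1 - γ))).trace.re ^ (1 - γ)) := by
  have h1γ : 0 < 1 - γ := by linarith
  set t := (opPow X (1 / (1 - γ))).trace.re with htdef
  have htsum : t = ∑ i, hX.1.eigenvalues i ^ (1 / (1 - γ)) := by rw [htdef, opPow, trace_cfc hX.1]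
  constructor
  · set f : ℝ → ℝ := fun x => x ^ (1 / (1 - γ) - 1) * (t ^ γ)⁻¹
    have hf : ∀ i, 0 ≤ f (hX.1.eigenvalues i) := fun i => by
      have := hX.eigenvalues_nonneg i
      positivity
    refine ⟨cfc f X, ⟨posSemidef_cfc hX.1 hf, ?_⟩, ?_⟩
    · rw [opPow, cfc_comp_cfc hX.1, trace_cfc hX.1]
      have : ∀ i, f (hX.1.eigenvalues i) ^ (1 / γ) =
          hX.1.eigenvalues i ^ (1 / (1 - γ)) * t⁻¹ := by
        intro i
        have h0 := hX.eigenvalues_nonneg i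
        rw [Real.mul_rpow (by positivity) (by positivity), ← Real.rpow_mul h0,
          ← Real.rpow_neg ht.le, ← Real.rpow_mul ht.le]
        rw [show (1 / (1 - γ) - 1) * (1 / γ) = 1 / (1 - γ) by field_simp; ring,
          show -γ * (1 / γ) = -1 by field_simp, Real.rpow_neg_one]
      simp only [this]
      rw [← Finset.sum_mul, ← htsum, mul_inv_cancel₀ ht.ne']
    · rw [trace_mul_cfc_self hX.1]
      have : ∀ i, hX.1.eigenvalues i * f (hX.1.eigenvalues i) =
          hX.1.eigenvalues i ^ (1 / (1 - γ)) * (t ^ γ)⁻¹ := by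
        intro i
        rw [← mul_assoc]
        congr 1
        rcases (hX.eigenvalues_nonneg i).eq_or_lt with h | h
        · rw [← h, zero_mul, Real.zero_rpow (by positivity)]
        · rw [Real.rpow_sub_one h.ne']; field_simp
      simp only [this]
      rw [← Finset.sum_mul, ← htsum, Real.rpow_sub ht, Real.rpow_one, div_eq_mul_inv]
  · rintro _ ⟨W, hW, rfl⟩
    set r := t ^ (1 - γ)
    have hr : 0 < r := by positivity
    have h := trace_mul_le_of_forall hX.1 hW.1.1 (f₁ := id) (g₁ := id)
      (f₂ := fun x => r * (1 - γ) * (x / r) ^ (1 / (1 - γ))) (g₂ := fun _ => 1)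
      (f₃ := fun _ => 1) (g₃ := fun w => r * γ * w ^ (1 / γ)) (fun i j => by
        simpa using young_div hγ hγ1 (hX.eigenvalues_nonneg i) (hW.1.eigenvalues_nonneg j) hr)
    rw [cfc_id ℝ X hX.1.isSelfAdjoint, cfc_const_one ℝ X hX.1.isSelfAdjoint,
      cfc_const_one ℝ W hW.1.1.isSelfAdjoint, Matrix.mul_one, Matrix.one_mul,
      cfc_id ℝ W hW.1.1.isSelfAdjoint, trace_cfc hX.1, trace_cfc hW.1.1,
      ← Finset.mul_sum, ← Finset.mul_sum] at h
    have h3 : ∑ i, (hX.1.eigenvalues i / r) ^ (1 / (1 - γ)) = 1 := by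
      have : ∀ i, (hX.1.eigenvalues i / r) ^ (1 / (1 - γ)) =
          hX.1.eigenvalues i ^ (1 / (1 - γ)) / t := by
        intro i
        rw [Real.div_rpow (hX.eigenvalues_nonneg i) hr.le, ← Real.rpow_mul ht.le,
          mul_one_div_cancel h1γ.ne', Real.rpow_one]
      simp only [this]
      rw [← Finset.sum_div, ← htsum, div_self ht.ne']
    have h4 := hW.2
    rw [opPow, trace_cfc hW.1.1] at h4
    rw [h3] at h
    have h5 := mul_le_mul_of_nonneg_left h4 (by positivity : 0 ≤ r * γ)
    linarith

/-- `‖Y‖_β = inf tr Y V` over the polar ball, for `β = 1 / (1 + γ)`. -/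
theorem isGLB_polarBall {γ : ℝ} (hγ : 0 < γ) {Y : Matrix n n ℂ}
    (hY : Y.PosSemidef) (ht : 0 < (opPow Y (1 / (1 + γ))).trace.re) :
    IsGLB {r | ∃ V ∈ polarBall n γ, r = (Y * V).trace.re}
      ((opPow Y (1 / (1 + γ))).trace.re ^ (1 + γ)) := by
  have h1γ : 0 < 1 + γ := by linarith
  set t := (opPow Y (1 / (1 + γ))).trace.re with htdef
  have htsum : t = ∑ i, hY.1.eigenvalues i ^ (1 / (1 + γ)) := by rw [htdef, opPow, trace_cfc hY.1]
  constructor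
  · rintro _ ⟨V, hV, rfl⟩
    -- The scale `t ^ (-γ)` optimizes the reverse Young inequality.
    have hs : 0 < t ^ (-γ) := by positivity
    have h := trace_mul_le_of_forall hY.1 hV.1.1
      (f₁ := fun y => (1 + γ) * y ^ (1 / (1 + γ))) (g₁ := fun _ => 1)
      (f₂ := fun y => y) (g₂ := fun v => t ^ (-γ) * v)
      (f₃ := fun _ => 1) (g₃ := fun v => γ * (t ^ (-γ)) ^ (-(1 / γ)) * v ^ (-(1 / γ)))
      (fun i j => by
        have := reverse_young hγ (hY.eigenvalues_nonneg i) (hV.1.eigenvalues_pos j) hs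
        simp only [mul_one, one_mul]
        linarith)
    rw [cfc_id' ℝ Y hY.1.isSelfAdjoint, cfc_const_one ℝ Y hY.1.isSelfAdjoint,
      cfc_const_one ℝ V hV.1.1.isSelfAdjoint, Matrix.mul_one, Matrix.one_mul,
      trace_cfc hY.1, trace_cfc hV.1.1, ← Finset.mul_sum, ← Finset.mul_sum, ← htsum,
      cfc_const_mul_id (t ^ (-γ)) V hV.1.1.isSelfAdjoint, Matrix.mul_smul, trace_smul,
      Complex.smul_re, ← Real.rpow_mul ht.le, show -γ * -(1 / γ) = 1 by field_simp, Real.rpow_one]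
      at h
    have h4 := hV.2
    rw [opPow, trace_cfc hV.1.1] at h4
    have h5 := mul_le_mul_of_nonneg_left h4 (by positivity : 0 ≤ γ * t)
    have h6 : t ≤ t ^ (-γ) * (Y * V).trace.re := by
      simp only [smul_eq_mul] at h
      linarith
    rw [Real.rpow_neg ht.le, inv_mul_eq_div, le_div_iff₀ (by positivity)] at h6
    rwa [Real.rpow_add ht, Real.rpow_one]
  · intro b hb
    -- The operators `V` below are close to `Y ^ (-γ / (1 + γ))` on the support of `Y`, and they are
    -- large on its kernel.
    have key : ∀ e : ℝ, 0 < e → b ≤ t * (t + Fintype.card n * e) ^ γ := by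
      intro e he
      set c := t + Fintype.card n * e
      have hc : 0 < c := by positivity
      set f : ℝ → ℝ := fun y => (if y = 0 then e ^ (-γ) else y ^ (1 / (1 + γ) - 1)) * c ^ γ with hf
      have hfpos : ∀ i, 0 < f (hY.1.eigenvalues i) := by
        intro i
        have h0 := hY.eigenvalues_nonneg i
        rcases h0.eq_or_lt with h | h
        · simp only [hf, ← h, if_true]; positivity
        · simp only [hf, h.ne', if_false]; positivity
      refine hb ⟨cfc f Y, ⟨posDef_cfc hY.1 hfpos, ?_⟩, ?_⟩
      · rw [opPow, cfc_comp_cfc hY.1, trace_cfc hY.1]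
        have : ∀ i, f (hY.1.eigenvalues i) ^ (-(1 / γ)) ≤
            (hY.1.eigenvalues i ^ (1 / (1 + γ)) + e) * c⁻¹ := by
          intro i
          have h0 := hY.eigenvalues_nonneg i
          have hcc : (c ^ γ) ^ (-(1 / γ)) = c⁻¹ := by
            rw [← Real.rpow_mul hc.le, show γ * -(1 / γ) = -1 by field_simp, Real.rpow_neg_one]
          rcases h0.eq_or_lt with h | h
          · simp only [hf, ← h, if_true]
            rw [Real.mul_rpow (by positivity) (by positivity), hcc, ← Real.rpow_mul he.le,
              show -γ * -(1 / γ) = 1 by field_simp, Real.rpow_one, Real.zero_rpow (by positivity),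
              zero_add]
          · simp only [hf, h.ne', if_false]
            rw [Real.mul_rpow (by positivity) (by positivity), hcc, ← Real.rpow_mul h0,
              show (1 / (1 + γ) - 1) * -(1 / γ) = 1 / (1 + γ) by field_simp; ring]
            gcongr
            linarith
        refine (Finset.sum_le_sum fun i _ => this i).trans ?_
        rw [← Finset.sum_mul, Finset.sum_add_distrib, ← htsum]
        simp only [Finset.sum_const, Finset.card_univ, nsmul_eq_mul]
        exact (mul_inv_cancel₀ hc.ne').le
      · rw [trace_mul_cfc_self hY.1]
        have : ∀ i, hY.1.eigenvalues i * f (hY.1.eigenvalues i) =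
            hY.1.eigenvalues i ^ (1 / (1 + γ)) * c ^ γ := by
          intro i
          have h0 := hY.eigenvalues_nonneg i
          rcases h0.eq_or_lt with h | h
          · rw [← h, zero_mul, Real.zero_rpow (by positivity), zero_mul]
          · simp only [hf, h.ne', if_false]
            rw [Real.rpow_sub_one h.ne']; field_simp
        simp only [this]
        rw [← Finset.sum_mul, ← htsum]
    have hlim : Tendsto (fun e : ℝ => t * (t + Fintype.card n * e) ^ γ) (𝓝[>] 0)
        (𝓝 (t * (t + Fintype.card n * 0) ^ γ)) := by
      have : ContinuousAt (fun e : ℝ => t * (t + Fintype.card n * e) ^ γ) 0 := by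
        refine ContinuousAt.mul continuousAt_const (ContinuousAt.rpow_const (by fun_prop) ?_)
        right; exact hγ.le
      exact this.tendsto.mono_left nhdsWithin_le_nhds
    have := ge_of_tendsto hlim (eventually_nhdsWithin_of_forall fun e he => key e he)
    rw [Real.rpow_add ht, Real.rpow_one]
    simpa using this

end Balls


/-! ### Supports and powers -/

section Supports

variable {n : Type*} [Fintype n] [DecidableEq n]

/-- The orthogonal projection onto the support of a Hermitian operator. -/
noncomputable def suppProj (X : Matrix n n ℂ) : Matrix n n ℂ :=
  cfc (fun x : ℝ => if x = 0 then 0 else 1) X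

theorem suppProj_eq_mul {X : Matrix n n ℂ} (hX : X.IsHermitian) :
    suppProj X = cfc (fun x : ℝ => (if x = 0 then 0 else 1) / x) X * X :=
  cfc_eq_cfc_div_mul hX (by simp)

theorem mul_suppProj {X : Matrix n n ℂ} (hX : X.IsHermitian) : X * suppProj X = X := by
  conv_lhs => enter [1]; rw [← cfc_id ℝ X hX.isSelfAdjoint]
  conv_rhs => rw [← cfc_id ℝ X hX.isSelfAdjoint]
  rw [suppProj, cfc_mul_cfc hX]
  refine cfc_congr_eigenvalues hX fun i => ?_
  by_cases h : hX.eigenvalues i = 0 <;> simp [h]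

theorem suppProj_mul_self {X : Matrix n n ℂ} (hX : X.IsHermitian) :
    suppProj X * suppProj X = suppProj X := by
  rw [suppProj, cfc_mul_cfc hX]
  refine cfc_congr_eigenvalues hX fun i => ?_
  by_cases h : hX.eigenvalues i = 0 <;> simp [h]

theorem suppProj_of_posDef {X : Matrix n n ℂ} (hX : X.PosDef) : suppProj X = 1 := by
  rw [← cfc_const_one ℝ X hX.1.isSelfAdjoint]
  exact cfc_congr_eigenvalues hX.1 fun i => by simp [(hX.eigenvalues_pos i).ne']

theorem suppProj_suppInv {X : Matrix n n ℂ} (hX : X.IsHermitian) :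
    suppProj (suppInv X) = suppProj X := by
  rw [suppProj, suppInv, cfc_comp_cfc hX]
  simp [suppProj]

theorem suppInv_suppInv {X : Matrix n n ℂ} (hX : X.IsHermitian) : suppInv (suppInv X) = X := by
  rw [suppInv, suppInv, cfc_comp_cfc hX]
  simp only [inv_inv]
  exact cfc_id' ℝ X hX.isSelfAdjoint

theorem posSemidef_suppInv {X : Matrix n n ℂ} (hX : X.PosSemidef) : (suppInv X).PosSemidef :=
  posSemidef_cfc hX.1 fun i => inv_nonneg.2 (hX.eigenvalues_nonneg i)

theorem opPow_suppInv {X : Matrix n n ℂ} (hX : X.PosSemidef) (s : ℝ) :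
    opPow (suppInv X) s = opPow X (-s) := by
  rw [opPow, suppInv, cfc_comp_cfc hX.1, opPow]
  exact cfc_congr_nonneg hX fun x hx => by rw [Real.rpow_neg hx, Real.inv_rpow hx]

theorem posSemidef_opPow {X : Matrix n n ℂ} (hX : X.PosSemidef) (s : ℝ) :
    (opPow X s).PosSemidef :=
  posSemidef_cfc hX.1 fun i => Real.rpow_nonneg (hX.eigenvalues_nonneg i) s

theorem opPow_mul_opPow_half {X : Matrix n n ℂ} (hX : X.PosSemidef) {s : ℝ} (hs : s ≠ 0) :
    opPow X (s / 2) * opPow X (s / 2) = opPow X s := by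
  rw [opPow, cfc_mul_cfc hX.1, opPow]
  refine cfc_congr_nonneg hX fun x hx => ?_
  rw [← Real.rpow_add' hx (by simpa using hs), add_halves]

theorem opPow_neg_mul_opPow {X : Matrix n n ℂ} (hX : X.PosSemidef) {s : ℝ} (hs : s ≠ 0) :
    opPow X (-s) * opPow X s = suppProj X := by
  rw [opPow, opPow, cfc_mul_cfc hX.1, suppProj]
  refine cfc_congr_nonneg hX fun x hx => ?_
  rcases hx.eq_or_lt with rfl | hx
  · simp [Real.zero_rpow hs]
  · rw [← Real.rpow_add hx, neg_add_cancel, Real.rpow_zero, if_neg hx.ne']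

theorem opPow_kronecker {m : Type*} [Fintype m] [DecidableEq m] {X : Matrix m m ℂ}
    {Y : Matrix n n ℂ} (hX : X.PosSemidef) (hY : Y.PosSemidef) (s : ℝ) :
    opPow (X ⊗ₖ Y) s = opPow X s ⊗ₖ opPow Y s :=
  cfc_kronecker hX.1 hY.1 fun i j =>
    Real.mul_rpow (hX.eigenvalues_nonneg i) (hY.eigenvalues_nonneg j)

theorem suppProj_kronecker {m : Type*} [Fintype m] [DecidableEq m] {X : Matrix m m ℂ}
    {Y : Matrix n n ℂ} (hX : X.IsHermitian) (hY : Y.IsHermitian) :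
    suppProj (X ⊗ₖ Y) = suppProj X ⊗ₖ suppProj Y :=
  cfc_kronecker hX hY fun i j => by
    by_cases h1 : hX.eigenvalues i = 0 <;> by_cases h2 : hY.eigenvalues j = 0 <;> simp [h1, h2]

theorem trace_opPow_pos {X : Matrix n n ℂ} (hX : X.PosSemidef) (h0 : X ≠ 0) (s : ℝ) :
    0 < (opPow X s).trace.re := by
  rw [opPow, trace_cfc hX.1]
  have : ∃ i, hX.1.eigenvalues i ≠ 0 := by
    by_contra! h
    exact h0 (hX.1.eigenvalues_eq_zero_iff.1 (funext h))
  obtain ⟨i, hi⟩ := this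
  exact Finset.sum_pos' (fun j _ => Real.rpow_nonneg (hX.eigenvalues_nonneg j) s)
    ⟨i, Finset.mem_univ i, Real.rpow_pos_of_pos ((hX.eigenvalues_nonneg i).lt_of_ne' hi) s⟩

theorem dominated_iff_ker {L K : Matrix n n ℂ} :
    Dominated L K ↔ ∀ v : n → ℂ, K *ᵥ v = 0 → L *ᵥ v = 0 := by
  rw [Dominated, supp, supp, Submodule.orthogonal_le_orthogonal_iff]
  constructor
  · intro h v hv
    have h1 : WithLp.toLp 2 v ∈ LinearMap.ker (Matrix.toEuclideanLin L) := h (by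
      simp [Matrix.toLpLin_apply, hv])
    simpa [Matrix.toLpLin_apply] using h1
  · intro h v hv
    have h1 := h v.ofLp (by simpa [Matrix.toLpLin_apply] using hv)
    simp [Matrix.toLpLin_apply, h1]

theorem dominated_iff_mul_suppProj {L K : Matrix n n ℂ} (hK : K.IsHermitian) :
    Dominated L K ↔ L * suppProj K = L := by
  rw [dominated_iff_ker]
  constructor
  · intro h
    have h1 : L * (1 - suppProj K) = 0 := by
      ext i j
      have h2 := h ((1 - suppProj K) *ᵥ Pi.single j 1) (by
        rw [mulVec_mulVec, Matrix.mul_sub, Matrix.mul_one, mul_suppProj hK, sub_self, zero_mulVec])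
      rw [mulVec_mulVec, mulVec_single_one] at h2
      simpa using congrFun h2 i
    rw [Matrix.mul_sub, Matrix.mul_one, sub_eq_zero] at h1
    exact h1.symm
  · intro h v hv
    rw [← h, suppProj_eq_mul hK, ← mulVec_mulVec, ← mulVec_mulVec, hv, mulVec_zero, mulVec_zero]

theorem dominated_mul_conjTranspose_iff {m : Type*} [Fintype m] {M : Matrix n m ℂ}
    {K : Matrix n n ℂ} (hK : K.IsHermitian) :
    Dominated (M * Mᴴ) K ↔ suppProj K * M = M := by
  rw [dominated_iff_mul_suppProj hK]
  have hP : (suppProj K)ᴴ = suppProj K := isHermitian_cfc _ _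
  constructor
  · intro h
    have h1 := congrArg conjTranspose h
    rw [conjTranspose_mul, hP, conjTranspose_mul, conjTranspose_conjTranspose] at h1
    have h2 : (suppProj K - 1) * (M * Mᴴ) = 0 := by
      rw [Matrix.sub_mul, h1, Matrix.one_mul, sub_self]
    rw [Matrix.mul_self_mul_conjTranspose_eq_zero, Matrix.sub_mul, Matrix.one_mul, sub_eq_zero]
      at h2
    exact h2
  · intro h
    have h1 := congrArg conjTranspose h
    rw [conjTranspose_mul, hP] at h1
    rw [Matrix.mul_assoc, h1]

end Supports

/-! ### Tripartite vectors -/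

section Amplitudes

variable {A B C : Type*} [Fintype A] [DecidableEq A] [Fintype B] [DecidableEq B] [Fintype C]
  [DecidableEq C]

/-- The amplitudes of a vector of `A ⊗ B ⊗ C` as an operator from `C` to `A ⊗ B` (in the chosen
bases); the marginal of the pure state on `A ⊗ B` is `amp ψ * (amp ψ)ᴴ`. -/
def amp {A B C : Type*} (ψ : A → B → C → ℂ) : Matrix (A × B) C ℂ :=
  of fun p c => ψ p.1 p.2 c

/-- The amplitudes of the same vector, with the systems `B` and `C` exchanged. -/
def exch {A B C : Type*} (ψ : A → B → C → ℂ) : A → C → B → ℂ := fun a c b => ψ a b c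

/-- The amplitudes as an operator from `B ⊗ C` to `A`; `ampLeft ψ * (ampLeft ψ)ᴴ` is the marginal
on `A`. -/
def ampLeft {A B C : Type*} (ψ : A → B → C → ℂ) : Matrix A (B × C) ℂ :=
  of fun a p => ψ a p.1 p.2

/-- The amplitudes as an operator from `A ⊗ C` to `B`; `ampMid ψ * (ampMid ψ)ᴴ` is the marginal
on `B`. -/
def ampMid {A B C : Type*} (ψ : A → B → C → ℂ) : Matrix B (A × C) ℂ :=
  of fun b p => ψ p.1 b p.2

/-- The compression of `T ⊗ V` to the system `C` along `ψ`.  Up to a transposition, it is the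
partial trace over `A ⊗ B` of `(T ⊗ V ⊗ 1) |ψ⟩⟨ψ|`. -/
def gram (ψ : A → B → C → ℂ) (T : Matrix A A ℂ) (V : Matrix B B ℂ) : Matrix C C ℂ :=
  (amp ψ)ᴴ * (T ⊗ₖ V) * amp ψ

theorem gram_apply (ψ : A → B → C → ℂ) (T : Matrix A A ℂ) (V : Matrix B B ℂ) (c c' : C) :
    gram ψ T V c c' =
      ∑ a, ∑ b, ∑ a', ∑ b', star (ψ a b c) * T a a' * V b b' * ψ a' b' c' := by
  rw [gram, Matrix.mul_assoc]
  simp only [amp, Matrix.mul_apply, conjTranspose_apply, of_apply,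
    Fintype.sum_prod_type, kroneckerMap_apply, Finset.mul_sum]
  refine Finset.sum_congr rfl fun a _ => Finset.sum_congr rfl fun b _ =>
    Finset.sum_congr rfl fun a' _ => Finset.sum_congr rfl fun b' _ => by ring

/-- The number `⟨ψ| T ⊗ V ⊗ W |ψ⟩`, read on the system `C` and on the system `B`. -/
theorem trace_gram_mul_transpose (ψ : A → B → C → ℂ) (T : Matrix A A ℂ) (V : Matrix B B ℂ)
    (W : Matrix C C ℂ) :
    (gram ψ T V * Wᵀ).trace = (gram (exch ψ) T W * Vᵀ).trace := by
  simp only [trace, diag_apply, Matrix.mul_apply, gram_apply, exch, transpose_apply,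
    Finset.sum_mul]
  simp only [← Fintype.sum_prod_type']
  refine Fintype.sum_equiv
    ⟨fun x => (x.2.2.2.1, x.2.2.2.2.2, x.2.2.1, x.1, x.2.2.2.2.1, x.2.1),
      fun x => (x.2.2.2.1, x.2.2.2.2.2, x.2.2.1, x.1, x.2.2.2.2.1, x.2.1),
      fun x => rfl, fun x => rfl⟩ _ _ fun x => ?_
  simp only [Equiv.coe_fn_mk]
  ring

theorem gram_smul_right (ψ : A → B → C → ℂ) (T : Matrix A A ℂ) (V : Matrix B B ℂ) (r : ℝ) :
    gram ψ T (r • V) = r • gram ψ T V := by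
  simp [gram, kronecker_smul]

theorem gram_add_right (ψ : A → B → C → ℂ) (T : Matrix A A ℂ) (V V' : Matrix B B ℂ) :
    gram ψ T (V + V') = gram ψ T V + gram ψ T V' := by
  simp [gram, kronecker_add, Matrix.mul_add, Matrix.add_mul]

theorem posSemidef_gram (ψ : A → B → C → ℂ) {T : Matrix A A ℂ} {V : Matrix B B ℂ}
    (hT : T.PosSemidef) (hV : V.PosSemidef) : (gram ψ T V).PosSemidef :=
  (hT.kronecker hV).conjTranspose_mul_mul_same _

theorem kronecker_one_mul_amp_apply (ψ : A → B → C → ℂ) (M : Matrix A A ℂ) (a : A) (b : B)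
    (c : C) : ((M ⊗ₖ (1 : Matrix B B ℂ)) * amp ψ) (a, b) c = (M * ampLeft ψ) a (b, c) := by
  simp [Matrix.mul_apply, Fintype.sum_prod_type, amp, ampLeft, one_apply]

theorem one_kronecker_mul_amp_apply (ψ : A → B → C → ℂ) (M : Matrix B B ℂ) (a : A) (b : B)
    (c : C) : (((1 : Matrix A A ℂ) ⊗ₖ M) * amp ψ) (a, b) c = (M * ampMid ψ) b (a, c) := by
  simp [Matrix.mul_apply, Fintype.sum_prod_type, amp, ampMid, one_apply]

theorem kronecker_one_mul_amp {ψ : A → B → C → ℂ} {P : Matrix A A ℂ} :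
    (P ⊗ₖ (1 : Matrix B B ℂ)) * amp ψ = amp ψ ↔ P * ampLeft ψ = ampLeft ψ := by
  have h := kronecker_one_mul_amp_apply ψ P
  constructor
  · intro h1
    ext a ⟨b, c⟩
    rw [← h, h1]; rfl
  · intro h1
    ext ⟨a, b⟩ c
    rw [h, h1]; rfl

theorem one_kronecker_mul_amp {ψ : A → B → C → ℂ} {P : Matrix B B ℂ} :
    ((1 : Matrix A A ℂ) ⊗ₖ P) * amp ψ = amp ψ ↔ P * ampMid ψ = ampMid ψ := by
  have h := one_kronecker_mul_amp_apply ψ P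
  constructor
  · intro h1
    ext b ⟨a, c⟩
    rw [← h, h1]; rfl
  · intro h1
    ext ⟨a, b⟩ c
    rw [h, h1]; rfl

theorem ampLeft_exch_iff {ψ : A → B → C → ℂ} {P : Matrix A A ℂ} :
    P * ampLeft (exch ψ) = ampLeft (exch ψ) ↔ P * ampLeft ψ = ampLeft ψ := by
  have h : ∀ a b c, (P * ampLeft (exch ψ)) a (c, b) = (P * ampLeft ψ) a (b, c) := fun a b c => rfl
  constructor
  · intro h1
    ext a ⟨b, c⟩
    rw [← h, h1]; rfl
  · intro h1
    ext a ⟨c, b⟩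
    rw [h, h1]; rfl

theorem traceRight_amp (ψ : A → B → C → ℂ) :
    traceRight (amp ψ * (amp ψ)ᴴ) = ampLeft ψ * (ampLeft ψ)ᴴ := by
  ext a a'
  simp [traceRight, amp, ampLeft, Matrix.mul_apply, Fintype.sum_prod_type]

/-- If `τ` dominates the marginal on `A`, then `τ ⊗ σ` dominates the marginal on `A ⊗ B` exactly
if `σ` dominates the marginal on `B`. -/
theorem dominated_amp_iff {ψ : A → B → C → ℂ} {τ : Matrix A A ℂ} {σ : Matrix B B ℂ}
    (hτ : τ.IsHermitian) (hσ : σ.IsHermitian) (hA : suppProj τ * ampLeft ψ = ampLeft ψ) :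
    Dominated (amp ψ * (amp ψ)ᴴ) (τ ⊗ₖ σ) ↔ suppProj σ * ampMid ψ = ampMid ψ := by
  have hK : (τ ⊗ₖ σ).IsHermitian := by
    rw [IsHermitian, conjTranspose_kronecker, hτ, hσ]
  rw [dominated_mul_conjTranspose_iff hK, suppProj_kronecker hτ hσ, ← one_kronecker_mul_amp]
  have hA' := kronecker_one_mul_amp.2 hA
  have h1 : suppProj τ ⊗ₖ suppProj σ =
      ((1 : Matrix A A ℂ) ⊗ₖ suppProj σ) * (suppProj τ ⊗ₖ (1 : Matrix B B ℂ)) := by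
    rw [← mul_kronecker_mul, Matrix.one_mul, Matrix.mul_one]
  rw [h1, Matrix.mul_assoc, hA']

theorem suppProj_kronecker_mul_amp {ψ : A → B → C → ℂ} {τ : Matrix A A ℂ} {σ : Matrix B B ℂ}
    (hA : suppProj τ * ampLeft ψ = ampLeft ψ) (hB : suppProj σ * ampMid ψ = ampMid ψ) :
    (suppProj τ ⊗ₖ suppProj σ) * amp ψ = amp ψ := by
  have h1 : suppProj τ ⊗ₖ suppProj σ =
      ((1 : Matrix A A ℂ) ⊗ₖ suppProj σ) * (suppProj τ ⊗ₖ (1 : Matrix B B ℂ)) := by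
    rw [← mul_kronecker_mul, Matrix.one_mul, Matrix.mul_one]
  rw [h1, Matrix.mul_assoc, kronecker_one_mul_amp.2 hA, one_kronecker_mul_amp.2 hB]

theorem gram_opPow_ne_zero {ψ : A → B → C → ℂ} {τ : Matrix A A ℂ} {σ : Matrix B B ℂ}
    (hτ : τ.PosSemidef) (hσ : σ.PosSemidef) (hψ : amp ψ ≠ 0)
    (hA : suppProj τ * ampLeft ψ = ampLeft ψ) (hB : suppProj σ * ampMid ψ = ampMid ψ)
    {s t : ℝ} (hs : s ≠ 0) (ht : t ≠ 0) : gram ψ (opPow τ s) (opPow σ t) ≠ 0 := by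
  intro h
  set S := opPow τ (s / 2) ⊗ₖ opPow σ (t / 2)
  have hS : Sᴴ = S := by
    rw [conjTranspose_kronecker, (posSemidef_opPow hτ _).1, (posSemidef_opPow hσ _).1]
  have h1 : gram ψ (opPow τ s) (opPow σ t) = (S * amp ψ)ᴴ * (S * amp ψ) := by
    rw [gram, ← opPow_mul_opPow_half hτ hs, ← opPow_mul_opPow_half hσ ht, mul_kronecker_mul,
      conjTranspose_mul, hS]
    simp only [S, Matrix.mul_assoc]
  rw [h1, conjTranspose_mul_self_eq_zero] at h
  have h2 := suppProj_kronecker_mul_amp hA hB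
  rw [← opPow_neg_mul_opPow hτ (s := s / 2) (by simpa using hs),
    ← opPow_neg_mul_opPow hσ (s := t / 2) (by simpa using ht), mul_kronecker_mul,
    Matrix.mul_assoc, h, Matrix.mul_zero] at h2
  exact hψ h2.symm

/-- The trace in the sandwiched divergence, moved to the purifying system. -/
theorem trace_sandwich {ψ : A → B → C → ℂ} {τ : Matrix A A ℂ} {σ : Matrix B B ℂ}
    (hτ : τ.PosSemidef) (hσ : σ.PosSemidef) {s a : ℝ} (hs : s ≠ 0) (ha : a ≠ 0) :
    (opPow (opPow (τ ⊗ₖ σ) (s / 2) * (amp ψ * (amp ψ)ᴴ) * opPow (τ ⊗ₖ σ) (s / 2)) a).trace =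
      (opPow (gram ψ (opPow τ s) (opPow σ s)) a).trace := by
  have hK := hτ.kronecker hσ
  have hS : (opPow (τ ⊗ₖ σ) (s / 2))ᴴ = opPow (τ ⊗ₖ σ) (s / 2) := isHermitian_cfc _ _
  have h1 : opPow (τ ⊗ₖ σ) (s / 2) * (amp ψ * (amp ψ)ᴴ) * opPow (τ ⊗ₖ σ) (s / 2) =
      (opPow (τ ⊗ₖ σ) (s / 2) * amp ψ) * (opPow (τ ⊗ₖ σ) (s / 2) * amp ψ)ᴴ := by
    rw [conjTranspose_mul, hS]
    simp only [Matrix.mul_assoc]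
  have h2 : gram ψ (opPow τ s) (opPow σ s) =
      (opPow (τ ⊗ₖ σ) (s / 2) * amp ψ)ᴴ * (opPow (τ ⊗ₖ σ) (s / 2) * amp ψ) := by
    rw [gram, ← opPow_kronecker hτ hσ, ← opPow_mul_opPow_half hK hs, conjTranspose_mul, hS]
    simp only [Matrix.mul_assoc]
  rw [h1, h2]
  exact trace_cfc_mul_conjTranspose _ (Real.zero_rpow ha)

end Amplitudes


/-! ### States inside the two balls -/

section States

variable {n : Type*} [Fintype n] [DecidableEq n]

theorem mem_states_of_trace_re {ρ : Matrix n n ℂ} (hρ : ρ.PosSemidef) (h : ρ.trace.re = 1) :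
    ρ ∈ states n := by
  refine ⟨hρ, Complex.ext (by simpa using h) ?_⟩
  have := (Complex.le_def.1 hρ.trace_nonneg).2
  simpa using this.symm

theorem trace_mul_re_nonneg {X Y : Matrix n n ℂ} (hX : X.PosSemidef) (hY : Y.PosSemidef) :
    0 ≤ (X * Y).trace.re := by
  obtain ⟨p, hp, hpt⟩ := exists_weights hX.1 hY.1
  have := hpt id id
  rw [cfc_id ℝ X hX.1.isSelfAdjoint, cfc_id ℝ Y hY.1.isSelfAdjoint] at this
  rw [this]
  exact Finset.sum_nonneg fun i _ => Finset.sum_nonneg fun j _ => mul_nonneg (hp i j)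
    (mul_nonneg (hX.eigenvalues_nonneg i) (hY.eigenvalues_nonneg j))

theorem opPow_mem_dualBall {γ : ℝ} (hγ : 0 < γ) {ω : Matrix n n ℂ} (hω : ω ∈ states n) :
    opPow ω γ ∈ dualBall n γ := by
  refine ⟨posSemidef_opPow hω.1 γ, ?_⟩
  rw [opPow, opPow, cfc_comp_cfc hω.1.1, cfc_congr_nonneg hω.1 (g := id), cfc_id ℝ ω
    hω.1.1.isSelfAdjoint, hω.2]
  · simp
  · intro x hx
    rw [← Real.rpow_mul hx, mul_one_div_cancel hγ.ne', Real.rpow_one, id]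

/-- Every element of the polar ball is, up to a factor at least `1`, the power `-γ` of a positive
definite state. -/
theorem exists_state_opPow_neg [Nonempty n] {γ : ℝ} (hγ : 0 < γ) {V : Matrix n n ℂ}
    (hV : V ∈ polarBall n γ) : ∃ σ ∈ states n, σ.PosDef ∧ ∃ r : ℝ, 0 < r ∧ r ≤ 1 ∧
      opPow σ (-γ) = r • V := by
  set s := (opPow V (-(1 / γ))).trace.re with hs
  have hssum : s = ∑ i, hV.1.1.eigenvalues i ^ (-(1 / γ)) :=
    trace_cfc hV.1.1 _
  have hs0 : 0 < s := by
    rw [hssum]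
    exact Finset.sum_pos (fun i _ => Real.rpow_pos_of_pos (hV.1.eigenvalues_pos i) _)
      Finset.univ_nonempty
  have hpos : ∀ i, 0 < s⁻¹ * hV.1.1.eigenvalues i ^ (-(1 / γ)) := fun i => by
    have := hV.1.eigenvalues_pos i
    positivity
  refine ⟨cfc (fun x => s⁻¹ * x ^ (-(1 / γ))) V, mem_states_of_trace_re
    (posSemidef_cfc hV.1.1 fun i => (hpos i).le) ?_, posDef_cfc hV.1.1 hpos, s ^ γ,
    Real.rpow_pos_of_pos hs0 _, Real.rpow_le_one hs0.le hV.2 hγ.le, ?_⟩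
  · rw [trace_cfc hV.1.1, ← Finset.mul_sum, ← hssum, inv_mul_cancel₀ hs0.ne']
  · rw [opPow, cfc_comp_cfc hV.1.1, ← cfc_const_mul_id (s ^ γ) V hV.1.1.isSelfAdjoint]
    refine cfc_congr_eigenvalues hV.1.1 fun i => ?_
    have h := hV.1.eigenvalues_pos i
    rw [Real.mul_rpow (by positivity) (by positivity), ← Real.rpow_mul h.le,
      Real.inv_rpow hs0.le, Real.rpow_neg hs0.le, inv_inv,
      show -(1 / γ) * -γ = 1 by field_simp, Real.rpow_one]

/-- Every element of the dual ball is, up to a factor close to `1`, bounded by the power `γ` of a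
positive definite state. -/
theorem exists_state_opPow_ge [Nonempty n] {γ : ℝ} (hγ : 0 < γ) {W : Matrix n n ℂ}
    (hW : W ∈ dualBall n γ) {k : ℝ} (hk : 0 < k) (hk1 : k < 1) :
    ∃ ω ∈ states n, ω.PosDef ∧ (opPow ω γ - k ^ γ • W).PosSemidef := by
  have hH := hW.1.1
  set d : ℝ := (Fintype.card n : ℝ)
  have hd : 0 < d := by
    simp only [d]
    exact_mod_cast Fintype.card_pos
  have h1k : 0 < 1 - k := by linarith
  set g : ℝ → ℝ := fun x => k * x ^ (1 / γ) + (1 - k) / d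
  set u := ∑ i, g (hH.eigenvalues i)
  have hg : ∀ i, 0 < g (hH.eigenvalues i) := fun i => by
    have := hW.1.eigenvalues_nonneg i
    positivity
  have hu : 0 < u := Finset.sum_pos (fun i _ => hg i) Finset.univ_nonempty
  have hu1 : u ≤ 1 := by
    have h2 := hW.2
    rw [opPow, trace_cfc hH] at h2
    have h3 : u = k * ∑ i, hH.eigenvalues i ^ (1 / γ) + (1 - k) := by
      simp only [u, g, Finset.sum_add_distrib, ← Finset.mul_sum, Finset.sum_const,
        Finset.card_univ, nsmul_eq_mul]
      congr 1
      exact mul_div_cancel₀ _ hd.ne'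
    nlinarith
  have hpos : ∀ i, 0 < g (hH.eigenvalues i) / u := fun i => div_pos (hg i) hu
  refine ⟨cfc (fun x => g x / u) W, mem_states_of_trace_re
    (posSemidef_cfc hH fun i => (hpos i).le) ?_, posDef_cfc hH hpos, ?_⟩
  · rw [trace_cfc hH, ← Finset.sum_div, div_self hu.ne']
  · have hsub : opPow (cfc (fun x => g x / u) W) γ - k ^ γ • W =
        cfc (fun x => (g x / u) ^ γ + -(k ^ γ) * x) W := by
      have hfin := W.finite_real_spectrum (𝕜 := ℂ)
      rw [opPow, cfc_comp_cfc hH, cfc_add (a := W) _ _ (hfin.continuousOn _) (hfin.continuousOn _),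
        cfc_const_mul_id _ W hH.isSelfAdjoint, neg_smul, sub_eq_add_neg]
    rw [hsub]
    refine posSemidef_cfc hH fun i => ?_
    have h0 := hW.1.eigenvalues_nonneg i
    have h2 : k * hH.eigenvalues i ^ (1 / γ) ≤ g (hH.eigenvalues i) / u := by
      rw [le_div_iff₀ hu]
      have : 0 ≤ k * hH.eigenvalues i ^ (1 / γ) := by positivity
      have h3 : 0 < (1 - k) / d := by positivity
      simp only [g]
      nlinarith
    have h3 := Real.rpow_le_rpow (by positivity) h2 hγ.le
    rw [Real.mul_rpow hk.le (by positivity), ← Real.rpow_mul h0, one_div_mul_cancel hγ.ne',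
      Real.rpow_one] at h3
    linarith

end States

/-! ### The minimax theorem -/

section Minimax

variable {A B C : Type*} [Fintype A] [DecidableEq A] [Fintype B] [DecidableEq B] [Fintype C]
  [DecidableEq C]

/-- Filling in the kernel of `σ` does not change the Gram operator of a vector supported on the
support of `σ`. -/
theorem exists_mem_polarBall_gram {ψ : A → B → C → ℂ} (T : Matrix A A ℂ) {σ : Matrix B B ℂ}
    (hσ : σ ∈ states B) (hB : suppProj σ * ampMid ψ = ampMid ψ) {γ : ℝ} (hγ : 0 < γ) {e : ℝ}
    (he : 0 < e) : ∃ V ∈ polarBall B γ,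
      gram ψ T V = ((1 + Fintype.card B * e) ^ γ) • gram ψ T (opPow σ (-γ)) := by
  have hH := hσ.1.1
  set c : ℝ := 1 + Fintype.card B * e
  have hc : 0 < c := by positivity
  set f : ℝ → ℝ := fun x => c ^ γ * (if x = 0 then e ^ (-γ) else x ^ (-γ)) with hf
  have hpos : ∀ i, 0 < f (hH.eigenvalues i) := by
    intro i
    have h0 := hσ.1.eigenvalues_nonneg i
    rcases h0.eq_or_lt with h | h
    · simp only [hf, ← h, if_true]; positivity
    · simp only [hf, h.ne', if_false]; positivity
  refine ⟨cfc f σ, ⟨posDef_cfc hH hpos, ?_⟩, ?_⟩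
  · rw [opPow, cfc_comp_cfc hH, trace_cfc hH]
    have : ∀ i, f (hH.eigenvalues i) ^ (-(1 / γ)) ≤ c⁻¹ * (hH.eigenvalues i + e) := by
      intro i
      have h0 := hσ.1.eigenvalues_nonneg i
      have hcc : (c ^ γ) ^ (-(1 / γ)) = c⁻¹ := by
        rw [← Real.rpow_mul hc.le, show γ * -(1 / γ) = -1 by field_simp, Real.rpow_neg_one]
      rcases h0.eq_or_lt with h | h
      · simp only [hf, ← h, if_true]
        rw [Real.mul_rpow (by positivity) (by positivity), hcc, ← Real.rpow_mul he.le,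
          show -γ * -(1 / γ) = 1 by field_simp, Real.rpow_one, zero_add]
      · simp only [hf, h.ne', if_false]
        rw [Real.mul_rpow (by positivity) (by positivity), hcc, ← Real.rpow_mul h0,
          show -γ * -(1 / γ) = 1 by field_simp, Real.rpow_one]
        gcongr
        linarith
    refine (Finset.sum_le_sum fun i _ => this i).trans ?_
    have htr : ∑ i, hH.eigenvalues i = 1 := by
      have := trace_cfc hH id
      rw [cfc_id ℝ σ hH.isSelfAdjoint, hσ.2] at this
      simpa using this.symm
    rw [← Finset.mul_sum, Finset.sum_add_distrib, htr]
    simp only [Finset.sum_const, Finset.card_univ, nsmul_eq_mul]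
    exact (inv_mul_cancel₀ hc.ne').le
  · have h1 : ∀ V : Matrix B B ℂ, gram ψ T V = gram ψ T (V * suppProj σ) := by
      intro V
      have h2 := one_kronecker_mul_amp (A := A).2 hB
      have h3 : T ⊗ₖ (V * suppProj σ) = (T ⊗ₖ V) * ((1 : Matrix A A ℂ) ⊗ₖ suppProj σ) := by
        rw [← mul_kronecker_mul, Matrix.mul_one]
      rw [gram, gram, h3, Matrix.mul_assoc, Matrix.mul_assoc, Matrix.mul_assoc, h2]
    rw [← gram_smul_right, h1, h1 (c ^ γ • opPow σ (-γ)), Matrix.smul_mul, suppProj, opPow,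
      cfc_mul_cfc hH, cfc_mul_cfc hH, ← cfc_const_mul _ _ _ (σ.finite_real_spectrum.continuousOn _)]
    congr 1
    refine cfc_congr_eigenvalues hH fun i => ?_
    by_cases h : hH.eigenvalues i = 0 <;> simp [hf, h]

/-- Sion's minimax theorem for the bilinear function `(V, W) ↦ ⟨ψ| T ⊗ V ⊗ W |ψ⟩` on the two
balls. -/
theorem exists_dualBall_forall_polarBall (ψ : A → B → C → ℂ) (T : Matrix A A ℂ) {γ : ℝ}
    (hγ : 0 < γ) (hγ1 : γ ≤ 1) {c c' : ℝ} (hc : c' < c)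
    (h : ∀ V ∈ polarBall B γ, ∃ W ∈ dualBall C γ, c ≤ (gram ψ T V * Wᵀ).trace.re) :
    ∃ W ∈ dualBall C γ, ∀ V ∈ polarBall B γ, c' ≤ (gram ψ T V * Wᵀ).trace.re := by
  set f : Matrix C C ℂ → Matrix B B ℂ → EReal := fun W V =>
    ((-(gram ψ T V * Wᵀ).trace.re : ℝ) : EReal) with hf
  let L : Matrix B B ℂ → Matrix C C ℂ →ₗ[ℝ] ℝ := fun V =>
    { toFun := fun W => -(gram ψ T V * Wᵀ).trace.re
      map_add' := fun W W' => by simp [Matrix.mul_add]; ring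
      map_smul' := fun r W => by simp }
  let R : Matrix C C ℂ → Matrix B B ℂ →ₗ[ℝ] ℝ := fun W =>
    { toFun := fun V => -(gram ψ T V * Wᵀ).trace.re
      map_add' := fun V V' => by simp [gram_add_right, Matrix.add_mul]; ring
      map_smul' := fun r V => by simp [gram_smul_right] }
  have hmono : Monotone ((↑) : ℝ → EReal) := EReal.coe_strictMono.monotone
  have hne : (dualBall C γ).Nonempty := ⟨0, PosSemidef.zero, by
    have h0 : cfc (fun x : ℝ => x ^ (1 / γ)) (0 : Matrix C C ℂ) = 0 := by
      rw [cfc_apply_zero, Real.zero_rpow (by positivity), map_zero]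
    rw [opPow, h0]
    simp⟩
  have hcontL : ∀ V, Continuous fun W => -(gram ψ T V * Wᵀ).trace.re := fun V => by fun_prop
  have hcontR : ∀ W, Continuous fun V => -(gram ψ T V * Wᵀ).trace.re := fun W =>
    (R W).continuous_of_finiteDimensional
  have key := Sion.minimax' (f := f) hne (convex_dualBall hγ hγ1) (isCompact_dualBall hγ hγ1)
    (fun V _ => (continuous_coe_real_ereal.comp (hcontL V)).lowerSemicontinuous
      |>.lowerSemicontinuousOn _)
    (fun V _ => QuasiconvexOn.monotone_comp (g := Real.toEReal) hmono
      ((L V).convexOn (convex_dualBall hγ hγ1)).quasiconvexOn)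
    (convex_polarBall hγ)
    (fun W _ => (continuous_coe_real_ereal.comp (hcontR W)).upperSemicontinuous
      |>.upperSemicontinuousOn _)
    (fun W _ => QuasiconcaveOn.monotone_comp (g := Real.toEReal) hmono
      ((R W).concaveOn (convex_polarBall hγ)).quasiconcaveOn)
  have h1 : (⨆ V ∈ polarBall B γ, ⨅ W ∈ dualBall C γ, f W V) ≤ ((-c : ℝ) : EReal) := by
    refine iSup₂_le fun V hV => ?_
    obtain ⟨W, hW, hWc⟩ := h V hV
    refine (iInf₂_le W hW).trans ?_
    simp only [hf]
    exact EReal.coe_le_coe_iff.2 (by linarith)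
  rw [← key] at h1
  have h2 : (⨅ W ∈ dualBall C γ, ⨆ V ∈ polarBall B γ, f W V) < ((-c' : ℝ) : EReal) :=
    h1.trans_lt (EReal.coe_lt_coe_iff.2 (by linarith))
  simp only [iInf_lt_iff] at h2
  obtain ⟨W, hW, hlt⟩ := h2
  refine ⟨W, hW, fun V hV => ?_⟩
  have h3 := (le_iSup₂ (f := fun V (_ : V ∈ polarBall B γ) => f W V) V hV).trans hlt.le
  simp only [hf] at h3
  have := EReal.coe_le_coe_iff.1 h3
  linarith

end Minimax


/-! ### Duality from the variational expressions -/

section Duality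

variable {A B C : Type*} [Fintype A] [DecidableEq A] [Fintype B] [DecidableEq B] [Fintype C]
  [DecidableEq C]

/-- The easy half `sup inf ≤ inf sup` of the minimax equality; here `σ ^ (-γ)` need not lie in the
polar ball, as `σ` may be singular. -/
theorem polar_le_dual {ψ : A → B → C → ℂ} {T : Matrix A A ℂ} {γ : ℝ} (hγ : 0 < γ)
    {σ : Matrix B B ℂ} (hσ : σ ∈ states B) (hB : suppProj σ * ampMid ψ = ampMid ψ)
    {ω : Matrix C C ℂ} (hω : ω ∈ states C) {n q : ℝ}
    (hn : n ∈ upperBounds {r | ∃ W ∈ dualBall C γ,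
      r = (gram ψ T (opPow σ (-γ)) * W).trace.re})
    (hq : q ∈ lowerBounds {r | ∃ V ∈ polarBall B γ,
      r = (gram (exch ψ) T (opPow ω γ) * V).trace.re}) : q ≤ n := by
  have key : ∀ e : ℝ, 0 < e → q ≤ (1 + Fintype.card B * e) ^ γ * n := by
    intro e he
    obtain ⟨V, hV, hVeq⟩ := exists_mem_polarBall_gram (ψ := ψ) T hσ hB hγ he
    have h1 := hq ⟨Vᵀ, transpose_mem_polarBall hV, rfl⟩
    rw [← trace_gram_mul_transpose, hVeq, Matrix.smul_mul, trace_smul, Complex.smul_re] at h1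
    have h2 := hn ⟨_, transpose_mem_dualBall (opPow_mem_dualBall hγ hω), rfl⟩
    exact h1.trans (mul_le_mul_of_nonneg_left h2 (by positivity))
  have hlim : Tendsto (fun e : ℝ => (1 + Fintype.card B * e) ^ γ * n) (𝓝[>] 0)
      (𝓝 ((1 + Fintype.card B * 0) ^ γ * n)) := by
    have : ContinuousAt (fun e : ℝ => (1 + Fintype.card B * e) ^ γ * n) 0 := by
      refine ContinuousAt.mul (ContinuousAt.rpow_const (by fun_prop) ?_) continuousAt_const
      right; exact hγ.le
    exact this.tendsto.mono_left nhdsWithin_le_nhds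
  have := ge_of_tendsto hlim (eventually_nhdsWithin_of_forall fun e he => key e he)
  simpa using this

theorem nonempty_of_amp_ne_zero {ψ : A → B → C → ℂ} (hψ : amp ψ ≠ 0) :
    Nonempty B ∧ Nonempty C := by
  by_contra h
  refine hψ ?_
  ext ⟨a, b⟩ c
  exact absurd ⟨⟨b⟩, ⟨c⟩⟩ h

/-- The duality, granted the variational expressions of the two divergences over the balls. -/
theorem sandwichedInfo_duality_of_variational {ψ : A → B → C → ℂ} (hψ : amp ψ ≠ 0)
    {τ T : Matrix A A ℂ} (hT : T.PosSemidef) {γ : ℝ} (hγ : 0 < γ) (hγ1 : γ ≤ 1) {α β : ℝ≥0∞}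
    (hα : ∀ σ ∈ states B, suppProj σ * ampMid ψ = ampMid ψ → ∃ n : ℝ, 0 < n ∧
      IsGreatest {r | ∃ W ∈ dualBall C γ, r = (gram ψ T (opPow σ (-γ)) * W).trace.re} n ∧
      sandwichedDiv α (amp ψ * (amp ψ)ᴴ) (τ ⊗ₖ σ) = ((1 / γ * Real.log n : ℝ) : EReal))
    (hα' : ∀ σ ∈ states B, suppProj σ * ampMid ψ ≠ ampMid ψ →
      sandwichedDiv α (amp ψ * (amp ψ)ᴴ) (τ ⊗ₖ σ) = ⊤)
    (hβ : ∀ ω ∈ states C, suppProj ω * ampMid (exch ψ) = ampMid (exch ψ) → ∃ q : ℝ, 0 < q ∧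
      IsGLB {r | ∃ V ∈ polarBall B γ, r = (gram (exch ψ) T (opPow ω γ) * V).trace.re} q ∧
      sandwichedDiv β (amp (exch ψ) * (amp (exch ψ))ᴴ) (suppInv τ ⊗ₖ ω) =
        ((-(1 / γ * Real.log q) : ℝ) : EReal))
    (hβ' : ∀ ω ∈ states C, suppProj ω * ampMid (exch ψ) ≠ ampMid (exch ψ) →
      sandwichedDiv β (amp (exch ψ) * (amp (exch ψ))ᴴ) (suppInv τ ⊗ₖ ω) = ⊤) :
    sandwichedInfo α (amp ψ * (amp ψ)ᴴ) τ =
      -sandwichedInfo β (amp (exch ψ) * (amp (exch ψ))ᴴ) (suppInv τ) := by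
  obtain ⟨hBne, hCne⟩ := nonempty_of_amp_ne_zero hψ
  apply le_antisymm
  · refine le_of_forall_lt fun c hc => ?_
    obtain ⟨r₂, hcr, hr₂⟩ := EReal.lt_iff_exists_real_btwn.1 hc
    obtain ⟨r₃, hr₂₃, hr₃⟩ := EReal.lt_iff_exists_real_btwn.1 hr₂
    have hr23 : r₂ < r₃ := EReal.coe_lt_coe_iff.1 hr₂₃
    refine hcr.trans_le ?_
    -- It remains to find a state `ω` of divergence at most `-r₂`.
    set r₁ := (r₂ + r₃) / 2
    have h1 : ∀ V ∈ polarBall B γ, ∃ W ∈ dualBall C γ,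
        Real.exp (γ * r₃) ≤ (gram ψ T V * Wᵀ).trace.re := by
      intro V hV
      obtain ⟨σ, hσ, hσd, r, hr, hr1, hrV⟩ := exists_state_opPow_neg hγ hV
      obtain ⟨n, hn, ⟨⟨W, hW, hWn⟩, -⟩, hD⟩ := hα σ hσ (by
        rw [suppProj_of_posDef hσd, Matrix.one_mul])
      have h2 : (r₃ : EReal) < ((1 / γ * Real.log n : ℝ) : EReal) := by
        rw [← hD]
        exact hr₃.trans_le (iInf₂_le σ hσ)
      have h3 : γ * r₃ < Real.log n := by
        have := EReal.coe_lt_coe_iff.1 h2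
        rwa [one_div_mul_eq_div, lt_div_iff₀ hγ, mul_comm] at this
      have h4 : Real.exp (γ * r₃) < n := (Real.lt_log_iff_exp_lt hn).1 h3
      refine ⟨Wᵀ, transpose_mem_dualBall hW, h4.le.trans ?_⟩
      rw [transpose_transpose]
      rw [hrV, gram_smul_right, Matrix.smul_mul, trace_smul, Complex.smul_re, smul_eq_mul] at hWn
      have h5 : 0 < (gram ψ T V * W).trace.re := by
        by_contra! h
        nlinarith
      nlinarith
    obtain ⟨W, hW, hWV⟩ := exists_dualBall_forall_polarBall ψ T hγ hγ1
      (c' := Real.exp (γ * r₁)) (Real.exp_lt_exp.2 (by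
        have : r₁ < r₃ := by simp only [r₁]; linarith
        nlinarith)) h1
    have hr12 : r₂ < r₁ := by simp only [r₁]; linarith
    obtain ⟨ω, hω, hωd, hωW⟩ := exists_state_opPow_ge hγ hW (k := Real.exp (r₂ - r₁))
      (Real.exp_pos _) (Real.exp_lt_one_iff.2 (by linarith))
    obtain ⟨q, hq, hglb, hD⟩ := hβ ω hω (by rw [suppProj_of_posDef hωd, Matrix.one_mul])
    have h6 : Real.exp (γ * r₂) ≤ q := by
      refine hglb.2 ?_
      rintro _ ⟨V, hV, rfl⟩
      have h7 := hWV _ (transpose_mem_polarBall hV)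
      rw [trace_gram_mul_transpose, transpose_transpose] at h7
      have h8 := trace_mul_re_nonneg (posSemidef_gram (exch ψ) hT hωW) hV.1.posSemidef
      rw [show opPow ω γ = (opPow ω γ - Real.exp (r₂ - r₁) ^ γ • W) +
        Real.exp (r₂ - r₁) ^ γ • W by abel, gram_add_right, Matrix.add_mul, trace_add,
        Complex.add_re, gram_smul_right, Matrix.smul_mul, trace_smul, Complex.smul_re,
        smul_eq_mul, ← Real.exp_mul]
      rw [← Real.exp_mul] at h8
      have h9 := mul_le_mul_of_nonneg_left h7 (Real.exp_pos ((r₂ - r₁) * γ)).le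
      rw [← Real.exp_add, show (r₂ - r₁) * γ + γ * r₁ = γ * r₂ by ring] at h9
      linarith
    rw [EReal.le_neg]
    refine (iInf₂_le ω hω).trans ?_
    rw [hD, ← EReal.coe_neg, EReal.coe_le_coe_iff, neg_le_neg_iff, one_div_mul_eq_div,
      le_div_iff₀ hγ, mul_comm]
    exact (Real.le_log_iff_exp_le hq).2 h6
  · refine le_iInf₂ fun σ hσ => ?_
    rw [EReal.neg_le]
    refine le_iInf₂ fun ω hω => ?_
    by_cases hB : suppProj σ * ampMid ψ = ampMid ψ
    · by_cases hC : suppProj ω * ampMid (exch ψ) = ampMid (exch ψ)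
      · obtain ⟨n, hn, hgr, hD⟩ := hα σ hσ hB
        obtain ⟨q, hq, hglb, hD'⟩ := hβ ω hω hC
        rw [hD, hD', ← EReal.coe_neg, EReal.coe_le_coe_iff, neg_le_neg_iff]
        have := Real.log_le_log hq (polar_le_dual hγ hσ hB hω hgr.2 hglb.1)
        gcongr
      · rw [hβ' ω hω hC]
        exact le_top
    · rw [hα' σ hσ hB, EReal.neg_top]
      exact bot_le

end Duality

/-! ### Variational expressions for finite orders other than one -/

section Formulas

variable {A B C : Type*} [Fintype A] [DecidableEq A] [Fintype B] [DecidableEq B] [Fintype C]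
  [DecidableEq C]

theorem sandwichedDiv_amp_eq_top {ψ : A → B → C → ℂ} {τ : Matrix A A ℂ} {σ : Matrix B B ℂ}
    (hτ : τ.IsHermitian) (hσ : σ.IsHermitian) (hA : suppProj τ * ampLeft ψ = ampLeft ψ)
    (hB : suppProj σ * ampMid ψ ≠ ampMid ψ) (α : ℝ≥0∞) :
    sandwichedDiv α (amp ψ * (amp ψ)ᴴ) (τ ⊗ₖ σ) = ⊤ := by
  rw [sandwichedDiv, if_neg]
  rwa [dominated_amp_iff hτ hσ hA]

/-- The sandwiched expression in terms of the Gram operator on the purifying system. -/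
theorem sandwichedExpr_amp {ψ : A → B → C → ℂ} {τ : Matrix A A ℂ} {σ : Matrix B B ℂ}
    (hτ : τ.PosSemidef) (hσ : σ.PosSemidef) {a : ℝ} (ha : a ≠ 0) (ha1 : a ≠ 1) :
    sandwichedExpr a (amp ψ * (amp ψ)ᴴ) (τ ⊗ₖ σ) = 1 / (a - 1) * Real.log
      (opPow (gram ψ (opPow τ (1 / a - 1)) (opPow σ (1 / a - 1))) a).trace.re := by
  rw [sandwichedExpr, show (1 - a) / (2 * a) = (1 / a - 1) / 2 by field_simp,
    trace_sandwich hτ hσ _ ha]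
  rw [sub_ne_zero, Ne, div_eq_iff ha, one_mul]
  exact ha1.symm

theorem sandwichedDiv_of_lt_top {ψ : A → B → C → ℂ} {τ : Matrix A A ℂ} {σ : Matrix B B ℂ}
    (hτ : τ.PosSemidef) (hσ : σ.PosSemidef) (hA : suppProj τ * ampLeft ψ = ampLeft ψ)
    (hB : suppProj σ * ampMid ψ = ampMid ψ) {α : ℝ≥0∞} (h0 : α ≠ 0) (h1 : α ≠ 1) (ht : α ≠ ∞) :
    sandwichedDiv α (amp ψ * (amp ψ)ᴴ) (τ ⊗ₖ σ) = ((1 / (α.toReal - 1) * Real.log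
      (opPow (gram ψ (opPow τ (1 / α.toReal - 1)) (opPow σ (1 / α.toReal - 1)))
        α.toReal).trace.re : ℝ) : EReal) := by
  rw [sandwichedDiv, if_pos ((dominated_amp_iff hτ.1 hσ.1 hA).2 hB), if_neg (by simp [h0, h1, ht]),
    sandwichedExpr_amp hτ hσ]
  · exact (ENNReal.toReal_pos h0 ht).ne'
  · intro h
    exact h1 ((ENNReal.toReal_eq_one_iff α).1 h)

theorem sandwichedDiv_variational_gt_one {ψ : A → B → C → ℂ} (hψ : amp ψ ≠ 0) {τ : Matrix A A ℂ}
    {σ : Matrix B B ℂ} (hτ : τ.PosSemidef) (hσ : σ.PosSemidef)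
    (hA : suppProj τ * ampLeft ψ = ampLeft ψ) (hB : suppProj σ * ampMid ψ = ampMid ψ)
    {γ : ℝ} (hγ : 0 < γ) (hγ1 : γ < 1) {α : ℝ≥0∞} (hα : α.toReal = 1 / (1 - γ)) :
    ∃ n : ℝ, 0 < n ∧ IsGreatest {r | ∃ W ∈ dualBall C γ,
        r = (gram ψ (opPow τ (-γ)) (opPow σ (-γ)) * W).trace.re} n ∧
      sandwichedDiv α (amp ψ * (amp ψ)ᴴ) (τ ⊗ₖ σ) = ((1 / γ * Real.log n : ℝ) : EReal) := by
  have h1γ : 0 < 1 - γ := by linarith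
  have hX := posSemidef_gram ψ (posSemidef_opPow hτ (-γ)) (posSemidef_opPow hσ (-γ))
  have ht := trace_opPow_pos hX (gram_opPow_ne_zero hτ hσ hψ hA hB (neg_ne_zero.2 hγ.ne')
    (neg_ne_zero.2 hγ.ne')) (1 / (1 - γ))
  refine ⟨_, Real.rpow_pos_of_pos ht _, isGreatest_dualBall hγ hγ1 hX ht, ?_⟩
  have hne : 1 / (1 - γ) ≠ 1 := by
    rw [Ne, div_eq_iff h1γ.ne']
    intro h; linarith
  rw [sandwichedDiv_of_lt_top hτ hσ hA hB, hα, Real.log_rpow ht]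
  · rw [show 1 / (1 / (1 - γ)) - 1 = -γ by field_simp; ring]
    congr 1
    rw [← mul_assoc]
    congr 1
    have : 1 / (1 - γ) - 1 = γ / (1 - γ) := by field_simp; ring
    rw [this]
    field_simp
  · rintro rfl
    have : 0 < 1 / (1 - γ) := by positivity
    simp at hα
    linarith
  · rintro rfl
    exact hne (by simpa using hα.symm)
  · rintro rfl
    have : 0 < 1 / (1 - γ) := by positivity
    simp at hα
    linarith

theorem sandwichedDiv_variational_lt_one {ψ : A → B → C → ℂ} (hψ : amp ψ ≠ 0) {τ : Matrix A A ℂ}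
    {σ : Matrix B B ℂ} (hτ : τ.PosSemidef) (hσ : σ.PosSemidef)
    (hA : suppProj τ * ampLeft ψ = ampLeft ψ) (hB : suppProj σ * ampMid ψ = ampMid ψ)
    {γ : ℝ} (hγ : 0 < γ) {β : ℝ≥0∞} (hβ : β.toReal = 1 / (1 + γ)) :
    ∃ q : ℝ, 0 < q ∧ IsGLB {r | ∃ V ∈ polarBall C γ,
        r = (gram ψ (opPow τ γ) (opPow σ γ) * V).trace.re} q ∧
      sandwichedDiv β (amp ψ * (amp ψ)ᴴ) (τ ⊗ₖ σ) = ((-(1 / γ * Real.log q) : ℝ) : EReal) := by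
  have h1γ : 0 < 1 + γ := by linarith
  have hX := posSemidef_gram ψ (posSemidef_opPow hτ γ) (posSemidef_opPow hσ γ)
  have ht := trace_opPow_pos hX (gram_opPow_ne_zero hτ hσ hψ hA hB hγ.ne' hγ.ne') (1 / (1 + γ))
  refine ⟨_, Real.rpow_pos_of_pos ht _, isGLB_polarBall hγ hX ht, ?_⟩
  have hne : 1 / (1 + γ) ≠ 1 := by
    rw [Ne, div_eq_iff h1γ.ne']
    intro h; linarith
  have hpos : 0 < 1 / (1 + γ) := by positivity
  rw [sandwichedDiv_of_lt_top hτ hσ hA hB, hβ, Real.log_rpow ht]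
  · rw [show 1 / (1 / (1 + γ)) - 1 = γ by field_simp; ring]
    congr 1
    rw [← mul_assoc, ← neg_mul]
    congr 1
    have : 1 / (1 + γ) - 1 = -(γ / (1 + γ)) := by field_simp; ring
    rw [this]
    field_simp
  · rintro rfl
    rw [← hβ] at hpos
    simp at hpos
  · rintro rfl
    exact hne (by simpa using hβ.symm)
  · rintro rfl
    rw [← hβ] at hpos
    simp at hpos

end Formulas


/-! ### Continuity of powers and the operator norm -/

section Continuity

variable {n : Type*} [Fintype n] [DecidableEq n]

theorem tendsto_opPow (X : Matrix n n ℂ) (hX : X.IsHermitian) {s : ℝ} (hs : s ≠ 0) :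
    Tendsto (fun t => opPow X t) (𝓝 s) (𝓝 (opPow X s)) := by
  have h : ∀ i, Tendsto (fun t => ((hX.eigenvalues i ^ t : ℝ) : ℂ)) (𝓝 s)
      (𝓝 ((hX.eigenvalues i ^ s : ℝ) : ℂ)) := fun i =>
    (Complex.continuous_ofReal.tendsto _).comp (Real.continuousAt_const_rpow' hs)
  have h2 : Tendsto (fun t => fun i => ((hX.eigenvalues i ^ t : ℝ) : ℂ)) (𝓝 s)
      (𝓝 fun i => ((hX.eigenvalues i ^ s : ℝ) : ℂ)) := tendsto_pi_nhds.2 h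
  have h3 : Continuous fun v : n → ℂ => (hX.eigenvectorUnitary : Matrix n n ℂ) * diagonal v *
      (hX.eigenvectorUnitary : Matrix n n ℂ)ᴴ := by fun_prop
  have h4 := (h3.tendsto _).comp h2
  simp only [opPow, cfc_eq_diag hX]
  exact h4

open scoped Matrix.Norms.L2Operator in
theorem norm_eq_norm_eigenvalues {X : Matrix n n ℂ} (hX : X.IsHermitian) :
    ‖X‖ = ‖fun i => (hX.eigenvalues i : ℂ)‖ := by
  conv_lhs => rw [eq_diag hX]
  rw [← star_eq_conjTranspose, ← Unitary.coe_star, CStarRing.norm_mul_coe_unitary,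
    CStarRing.norm_coe_unitary_mul, l2_opNorm_diagonal]

open scoped Matrix.Norms.L2Operator in
theorem eigenvalues_le_norm {X : Matrix n n ℂ} (hX : X.PosSemidef) (i : n) :
    hX.1.eigenvalues i ≤ ‖X‖ := by
  rw [norm_eq_norm_eigenvalues hX.1]
  have := norm_le_pi_norm (fun i => (hX.1.eigenvalues i : ℂ)) i
  rwa [Complex.norm_real, Real.norm_of_nonneg (hX.eigenvalues_nonneg i)] at this

open scoped Matrix.Norms.L2Operator in
theorem exists_eigenvalue_eq_norm [Nonempty n] {X : Matrix n n ℂ} (hX : X.PosSemidef) :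
    ∃ i, hX.1.eigenvalues i = ‖X‖ := by
  obtain ⟨i, hi⟩ := Finite.exists_max hX.1.eigenvalues
  refine ⟨i, (eigenvalues_le_norm hX i).antisymm ?_⟩
  rw [norm_eq_norm_eigenvalues hX.1, pi_norm_le_iff_of_nonneg (hX.eigenvalues_nonneg i)]
  intro j
  rw [Complex.norm_real, Real.norm_of_nonneg (hX.eigenvalues_nonneg j)]
  exact hi j

open scoped Matrix.Norms.L2Operator in
/-- The operator norm of a positive semidefinite operator is the largest of its expectations. -/
theorem isGreatest_dualBall_one [Nonempty n] {X : Matrix n n ℂ} (hX : X.PosSemidef) :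
    IsGreatest {r | ∃ W ∈ dualBall n 1, r = (X * W).trace.re} ‖X‖ := by
  constructor
  · obtain ⟨i, hi⟩ := exists_eigenvalue_eq_norm hX
    set s := Finset.univ.filter fun j => hX.1.eigenvalues j = ‖X‖
    have hs : 0 < (s.card : ℝ) := by
      exact_mod_cast Finset.card_pos.2 ⟨i, by simp [s, hi]⟩
    set f : ℝ → ℝ := fun x => if x = ‖X‖ then (s.card : ℝ)⁻¹ else 0 with hf
    have hsum : ∑ j, f (hX.1.eigenvalues j) = 1 := by
      simp only [hf, ← Finset.sum_filter]
      rw [Finset.sum_const, nsmul_eq_mul]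
      exact mul_inv_cancel₀ hs.ne'
    refine ⟨cfc f X, ⟨posSemidef_cfc hX.1 fun j => ?_, ?_⟩, ?_⟩
    · simp only [hf]
      split_ifs <;> positivity
    · rw [opPow, cfc_comp_cfc hX.1, trace_cfc hX.1]
      simp [hsum]
    · rw [trace_mul_cfc_self hX.1]
      have : ∀ j, hX.1.eigenvalues j * f (hX.1.eigenvalues j) = ‖X‖ * f (hX.1.eigenvalues j) := by
        intro j
        by_cases h : hX.1.eigenvalues j = ‖X‖
        · rw [h]
        · simp [hf, h]
      simp only [this]
      rw [← Finset.mul_sum, hsum, mul_one]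
  · rintro _ ⟨W, hW, rfl⟩
    have h := trace_mul_le_of_forall hX.1 hW.1.1 (f₁ := id) (g₁ := id)
      (f₂ := fun _ => 0) (g₂ := fun _ => 0) (f₃ := fun _ => 1) (g₃ := fun w => ‖X‖ * w)
      (fun i j => by
        simpa using mul_le_mul_of_nonneg_right (eigenvalues_le_norm hX i)
          (hW.1.eigenvalues_nonneg j))
    have h2 := hW.2
    rw [opPow, trace_cfc hW.1.1] at h2
    rw [cfc_id ℝ X hX.1.isSelfAdjoint, cfc_const_one ℝ X hX.1.isSelfAdjoint, Matrix.one_mul,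
      cfc_id ℝ W hW.1.1.isSelfAdjoint, trace_cfc hW.1.1, ← Finset.mul_sum] at h
    simp at h h2
    nlinarith [norm_nonneg X]

open scoped Matrix.Norms.L2Operator in
theorem log_trace_opPow_bounds [Nonempty n] {X : Matrix n n ℂ} (hX : X.PosSemidef) (h0 : X ≠ 0)
    {a : ℝ} (ha : 0 < a) : a * Real.log ‖X‖ ≤ Real.log (opPow X a).trace.re ∧
      Real.log (opPow X a).trace.re ≤ Real.log (Fintype.card n) + a * Real.log ‖X‖ := by
  have hn : 0 < ‖X‖ := norm_pos_iff.2 h0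
  have ht := trace_opPow_pos hX h0 a
  have hd : (0 : ℝ) < Fintype.card n := by exact_mod_cast Fintype.card_pos
  rw [← Real.log_rpow hn, ← Real.log_mul hd.ne' (by positivity)]
  constructor
  · refine Real.log_le_log (by positivity) ?_
    obtain ⟨i, hi⟩ := exists_eigenvalue_eq_norm hX
    rw [opPow, trace_cfc hX.1, ← hi]
    exact Finset.single_le_sum (f := fun i => hX.1.eigenvalues i ^ a)
      (fun j _ => Real.rpow_nonneg (hX.eigenvalues_nonneg j) _) (Finset.mem_univ i)
  · refine Real.log_le_log ht ?_
    rw [opPow, trace_cfc hX.1]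
    refine (Finset.sum_le_sum (g := fun _ => ‖X‖ ^ a) fun i _ =>
      Real.rpow_le_rpow (hX.eigenvalues_nonneg i) (eigenvalues_le_norm hX i) ha.le).trans ?_
    simp

theorem tendsto_toReal_nhdsNE_top : Tendsto ENNReal.toReal (𝓝[≠] ∞) atTop := by
  rw [tendsto_atTop]
  intro b
  have h : ∀ᶠ a : ℝ≥0∞ in 𝓝[≠] ∞, ENNReal.ofReal b < a :=
    eventually_nhdsWithin_of_eventually_nhds (lt_mem_nhds ENNReal.ofReal_lt_top)
  filter_upwards [h, self_mem_nhdsWithin] with a ha hat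
  exact (ENNReal.ofReal_le_iff_le_toReal hat).1 ha.le

end Continuity

/-! ### The divergence of order infinity -/

section OrderInfinity

variable {A B C : Type*} [Fintype A] [DecidableEq A] [Fintype B] [DecidableEq B] [Fintype C]
  [DecidableEq C]

theorem tendsto_gram_opPow (ψ : A → B → C → ℂ) {τ : Matrix A A ℂ} {σ : Matrix B B ℂ}
    (hτ : τ.IsHermitian) (hσ : σ.IsHermitian) {s : ℝ} (hs : s ≠ 0) :
    Tendsto (fun t => gram ψ (opPow τ t) (opPow σ t)) (𝓝 s)
      (𝓝 (gram ψ (opPow τ s) (opPow σ s))) := by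
  have h1 : ∀ a a', Tendsto (fun t => opPow τ t a a') (𝓝 s) (𝓝 (opPow τ s a a')) := fun a a' =>
    ((tendsto_opPow τ hτ hs).apply_nhds a).apply_nhds a'
  have h2 : ∀ b b', Tendsto (fun t => opPow σ t b b') (𝓝 s) (𝓝 (opPow σ s b b')) := fun b b' =>
    ((tendsto_opPow σ hσ hs).apply_nhds b).apply_nhds b'
  refine tendsto_pi_nhds.2 fun c => tendsto_pi_nhds.2 fun c' => ?_
  simp only [gram_apply]
  exact tendsto_finsetSum _ fun a _ => tendsto_finsetSum _ fun b _ => tendsto_finsetSum _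
    fun a' _ => tendsto_finsetSum _ fun b' _ =>
      ((tendsto_const_nhds.mul (h1 a a')).mul (h2 b b')).mul_const _

open scoped Matrix.Norms.L2Operator in
theorem sandwichedDiv_variational_top {ψ : A → B → C → ℂ} (hψ : amp ψ ≠ 0) {τ : Matrix A A ℂ}
    {σ : Matrix B B ℂ} (hτ : τ.PosSemidef) (hσ : σ.PosSemidef)
    (hA : suppProj τ * ampLeft ψ = ampLeft ψ) (hB : suppProj σ * ampMid ψ = ampMid ψ) :
    ∃ n : ℝ, 0 < n ∧ IsGreatest {r | ∃ W ∈ dualBall C 1,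
        r = (gram ψ (opPow τ (-1)) (opPow σ (-1)) * W).trace.re} n ∧
      sandwichedDiv ∞ (amp ψ * (amp ψ)ᴴ) (τ ⊗ₖ σ) = ((1 / 1 * Real.log n : ℝ) : EReal) := by
  obtain ⟨-, hCne⟩ := nonempty_of_amp_ne_zero hψ
  set X : ℝ → Matrix C C ℂ := fun s => gram ψ (opPow τ s) (opPow σ s)
  have hX : ∀ s, (X s).PosSemidef := fun s =>
    posSemidef_gram ψ (posSemidef_opPow hτ s) (posSemidef_opPow hσ s)
  have hX0 : ∀ s, s ≠ 0 → X s ≠ 0 := fun s hs => gram_opPow_ne_zero hτ hσ hψ hA hB hs hs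
  refine ⟨‖X (-1)‖, norm_pos_iff.2 (hX0 _ (by norm_num)), isGreatest_dualBall_one (hX _), ?_⟩
  have hs : Tendsto (fun a : ℝ => 1 / a - 1) atTop (𝓝 (-1)) := by
    have : Tendsto (fun a : ℝ => 1 / a - 1) atTop (𝓝 (0 - 1)) :=
      (tendsto_const_nhds.div_atTop tendsto_id).sub_const 1
    simpa using this
  have hXlim : Tendsto (fun a : ℝ => X (1 / a - 1)) atTop (𝓝 (X (-1))) := by
    have h1 : Tendsto X (𝓝 (-1)) (𝓝 (X (-1))) :=
      tendsto_gram_opPow ψ hτ.1 hσ.1 (by norm_num)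
    exact h1.comp hs
  have hlog : Tendsto (fun a : ℝ => Real.log ‖X (1 / a - 1)‖) atTop (𝓝 (Real.log ‖X (-1)‖)) :=
    hXlim.norm.log (norm_ne_zero_iff.2 (hX0 _ (by norm_num)))
  have hratio : Tendsto (fun a : ℝ => a / (a - 1)) atTop (𝓝 1) := by
    have h1 : Tendsto (fun a : ℝ => 1 + 1 / (a - 1)) atTop (𝓝 (1 + 0)) :=
      tendsto_const_nhds.add
        (tendsto_const_nhds.div_atTop (tendsto_atTop_add_const_right _ (-1) tendsto_id))
    rw [add_zero] at h1
    refine h1.congr' ?_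
    filter_upwards [eventually_gt_atTop 1] with a ha
    have : a - 1 ≠ 0 := by linarith
    field_simp
    ring
  have hcard : Tendsto (fun a : ℝ => Real.log (Fintype.card C) / (a - 1)) atTop (𝓝 0) :=
    tendsto_const_nhds.div_atTop (tendsto_atTop_add_const_right _ (-1) tendsto_id)
  have hmain : Tendsto (fun a : ℝ => sandwichedExpr a (amp ψ * (amp ψ)ᴴ) (τ ⊗ₖ σ)) atTop
      (𝓝 (Real.log ‖X (-1)‖)) := by
    have hlow := hratio.mul hlog
    have hupp := hcard.add hlow
    rw [one_mul] at hlow hupp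
    rw [zero_add] at hupp
    refine tendsto_of_tendsto_of_tendsto_of_le_of_le' hlow hupp ?_ ?_
    · filter_upwards [eventually_gt_atTop 1] with a ha
      have h1 : 0 < a - 1 := by linarith
      have h2 : 1 / a - 1 ≠ 0 := by
        rw [sub_ne_zero, Ne, div_eq_iff (by linarith)]; linarith
      rw [sandwichedExpr_amp hτ hσ (by linarith) (by linarith), one_div_mul_eq_div,
        le_div_iff₀ h1]
      have := (log_trace_opPow_bounds (hX _) (hX0 _ h2) (a := a) (by linarith)).1
      refine le_trans (le_of_eq ?_) this
      field_simp
    · filter_upwards [eventually_gt_atTop 1] with a ha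
      have h1 : 0 < a - 1 := by linarith
      have h2 : 1 / a - 1 ≠ 0 := by
        rw [sub_ne_zero, Ne, div_eq_iff (by linarith)]; linarith
      rw [sandwichedExpr_amp hτ hσ (by linarith) (by linarith), one_div_mul_eq_div,
        div_le_iff₀ h1]
      have := (log_trace_opPow_bounds (hX _) (hX0 _ h2) (a := a) (by linarith)).2
      refine this.trans (le_of_eq ?_)
      field_simp
  have hlim : Tendsto (fun a : ℝ≥0∞ => sandwichedExpr a.toReal (amp ψ * (amp ψ)ᴴ) (τ ⊗ₖ σ))
      (𝓝[≠] ∞) (𝓝 (Real.log ‖X (-1)‖)) := hmain.comp tendsto_toReal_nhdsNE_top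
  rw [sandwichedDiv, if_pos ((dominated_amp_iff hτ.1 hσ.1 hA).2 hB), if_pos (by simp),
    hlim.limUnder_eq]
  simp

end OrderInfinity


/-! ### The divergence of order one -/

section OrderOne

theorem abs_rpow_sub_div_sub_le {a x : ℝ} (ha : 0 < a) (ha1 : a ≠ 1) (hx : 0 ≤ x) :
    |(x ^ a - x) / (a - 1) - x * Real.log x| ≤ |x ^ a * Real.log x - x * Real.log x| := by
  rcases hx.eq_or_lt with rfl | hx
  · simp [Real.zero_rpow ha.ne']
  have ha' : a - 1 ≠ 0 := sub_ne_zero.2 ha1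
  set u := (a - 1) * Real.log x with hu
  have hxa : x ^ a = x * Real.exp u := by
    rw [Real.rpow_def_of_pos hx, hu]
    conv_rhs => enter [1]; rw [← Real.exp_log hx]
    rw [← Real.exp_add]
    ring_nf
  have h1 : 0 ≤ Real.exp u - 1 - u := by linarith [Real.add_one_le_exp u]
  have h2 : Real.exp u - 1 - u ≤ u * (Real.exp u - 1) := by
    have h3 := mul_le_mul_of_nonneg_left (Real.add_one_le_exp (-u)) (Real.exp_pos u).le
    rw [← Real.exp_add, add_neg_cancel, Real.exp_zero] at h3
    linarith
  have h4 : (x ^ a - x) / (a - 1) - x * Real.log x = x / (a - 1) * (Real.exp u - 1 - u) := by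
    rw [hxa, hu]
    field_simp
  have h5 : x ^ a * Real.log x - x * Real.log x = x / (a - 1) * (u * (Real.exp u - 1)) := by
    rw [hxa]
    have : Real.log x = u / (a - 1) := by rw [hu]; field_simp
    rw [this]
    field_simp
  rw [h4, h5, abs_mul, abs_mul, abs_of_nonneg h1, abs_of_nonneg (h1.trans h2)]
  exact mul_le_mul_of_nonneg_left h2 (abs_nonneg _)

/-- The difference quotients of `a ↦ x ^ a` at `a = 1` converge uniformly for bounded `x ≥ 0`. -/
theorem tendstoUniformlyOn_rpow_sub_div (M : ℝ) :
    TendstoUniformlyOn (fun a x : ℝ => (x ^ a - x) / (a - 1)) (fun x => x * Real.log x) (𝓝[≠] 1)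
      (Set.Icc 0 M) := by
  -- As `x ^ a * log x = x ^ (a - 1 / 2) * (√x * log x)`, this function is jointly continuous.
  have hsqrt : Continuous fun x : ℝ => 2 * (√x * Real.log √x) :=
    continuous_const.mul (Real.continuous_mul_log.comp Real.continuous_sqrt)
  have hcont : ContinuousOn (fun p : ℝ × ℝ => p.2 ^ (p.1 - 1 / 2) * (2 * (√p.2 * Real.log √p.2)))
      (Set.Icc (3 / 4) (5 / 4) ×ˢ Set.Icc 0 M) := by
    refine ContinuousOn.mul (ContinuousOn.rpow (by fun_prop) (by fun_prop) ?_)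
      (hsqrt.comp continuous_snd).continuousOn
    rintro ⟨a, x⟩ ⟨ha, -⟩
    right
    have := ha.1
    simp only at this ⊢
    linarith
  have hunif := (isCompact_Icc.prod isCompact_Icc).uniformContinuousOn_of_continuous hcont
  have hnhds : Set.Icc (3 / 4 : ℝ) (5 / 4) ∈ 𝓝 (1 : ℝ) :=
    Icc_mem_nhds (by norm_num) (by norm_num)
  have ht := UniformContinuousOn.tendstoUniformlyOn
    (F := fun a x : ℝ => x ^ (a - 1 / 2) * (2 * (√x * Real.log √x))) hunif (mem_of_mem_nhds hnhds)
  rw [Metric.tendstoUniformlyOn_iff] at ht ⊢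
  intro ε hε
  have ht' := ht ε hε
  rw [nhdsWithin_eq_nhds.2 hnhds] at ht'
  have hev : ∀ᶠ a : ℝ in 𝓝[≠] 1, a ∈ Set.Icc (3 / 4 : ℝ) (5 / 4) :=
    eventually_nhdsWithin_of_eventually_nhds hnhds
  filter_upwards [eventually_nhdsWithin_of_eventually_nhds ht', hev, self_mem_nhdsWithin] with
    a h1 ha ha1 x hx
  have hφ : ∀ b : ℝ, 1 / 2 < b → x ^ (b - 1 / 2) * (2 * (√x * Real.log √x)) =
      x ^ b * Real.log x := by
    intro b hb
    have hx0 := hx.1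
    rw [Real.log_sqrt hx0, Real.sqrt_eq_rpow, show x ^ (b - 1 / 2) *
      (2 * (x ^ (1 / 2 : ℝ) * (Real.log x / 2))) = (x ^ (b - 1 / 2) * x ^ (1 / 2 : ℝ)) *
        Real.log x by ring, ← Real.rpow_add' hx0 (by linarith)]
    ring_nf
  have h2 := h1 x hx
  rw [hφ 1 (by norm_num), hφ a (by linarith [ha.1]), Real.rpow_one, dist_comm, Real.dist_eq] at h2
  rw [dist_comm, Real.dist_eq]
  exact (abs_rpow_sub_div_sub_le (by linarith [ha.1]) ha1 hx.1).trans_lt h2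

variable {n : Type*} [Fintype n] [DecidableEq n]

theorem eigenvalues_le_trace {X : Matrix n n ℂ} (hX : X.PosSemidef) (i : n) :
    hX.1.eigenvalues i ≤ X.trace.re := by
  have h := trace_cfc hX.1 id
  rw [cfc_id ℝ X hX.1.isSelfAdjoint] at h
  rw [h]
  exact Finset.single_le_sum (f := fun i => hX.1.eigenvalues i)
    (fun j _ => hX.eigenvalues_nonneg j) (Finset.mem_univ i)

/-- `tr X ^ a - tr X` to first order in `a - 1`, for an operator `X` that moves with `a`. -/
theorem tendsto_trace_opPow_sub_div {X : ℝ → Matrix n n ℂ} {ρ : Matrix n n ℂ}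
    (hX : ∀ a, (X a).PosSemidef) (hρ : ρ.PosSemidef) (hlim : Tendsto X (𝓝[≠] 1) (𝓝 ρ)) :
    Tendsto (fun a => ((opPow (X a) a).trace.re - (X a).trace.re) / (a - 1)) (𝓝[≠] 1)
      (𝓝 (cfc (fun x => x * Real.log x) ρ).trace.re) := by
  set M := ρ.trace.re + 1
  have htr : Tendsto (fun a => (X a).trace.re) (𝓝[≠] 1) (𝓝 ρ.trace.re) := by
    have : Continuous fun Y : Matrix n n ℂ => Y.trace.re := by fun_prop
    exact (this.tendsto ρ).comp hlim
  have hM : ∀ᶠ a in 𝓝[≠] (1 : ℝ), (X a).trace.re ≤ M :=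
    (htr.eventually (gt_mem_nhds (lt_add_one _))).mono fun a h => h.le
  have hspec : ∀ {Y : Matrix n n ℂ}, Y.PosSemidef → Y.trace.re ≤ M →
      spectrum ℝ Y ⊆ Set.Icc 0 M := by
    intro Y hY hYM x hx
    rw [hY.1.spectrum_real_eq_range_eigenvalues] at hx
    obtain ⟨i, rfl⟩ := hx
    exact ⟨hY.eigenvalues_nonneg i, (eigenvalues_le_trace hY i).trans hYM⟩
  have h1 : Tendsto (fun a => (cfc (fun x => x * Real.log x) (X a)).trace.re) (𝓝[≠] 1)
      (𝓝 (cfc (fun x => x * Real.log x) ρ).trace.re) := by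
    open scoped Matrix.Norms.L2Operator in
    have h2 : Tendsto (fun a => cfc (fun x => x * Real.log x) (X a)) (𝓝[≠] 1)
        (𝓝 (cfc (fun x => x * Real.log x) ρ)) :=
      hlim.cfc (s := Set.Icc 0 M) isCompact_Icc (fun x => x * Real.log x)
        (hM.mono fun a ha => hspec (hX a) ha) (Eventually.of_forall fun a => (hX a).1.isSelfAdjoint)
        (hspec hρ (by simp [M])) hρ.1.isSelfAdjoint Real.continuous_mul_log.continuousOn
    have h3 : Continuous fun Y : Matrix n n ℂ => Y.trace.re := by fun_prop
    exact (h3.tendsto _).comp h2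
  refine tendsto_of_tendsto_of_dist h1 ?_
  rw [Metric.tendsto_nhds]
  intro ε hε
  have hd : 0 < ε / (Fintype.card n + 1) := by positivity
  have hu := Metric.tendstoUniformlyOn_iff.1 (tendstoUniformlyOn_rpow_sub_div M) _ hd
  filter_upwards [hu, hM] with a ha haM
  rw [Real.dist_eq, sub_zero, abs_of_nonneg dist_nonneg, Real.dist_eq]
  have hsum : (cfc (fun x => x * Real.log x) (X a)).trace.re -
      ((opPow (X a) a).trace.re - (X a).trace.re) / (a - 1) =
      ∑ i, ((hX a).1.eigenvalues i * Real.log ((hX a).1.eigenvalues i) -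
        ((hX a).1.eigenvalues i ^ a - (hX a).1.eigenvalues i) / (a - 1)) := by
    have h := trace_cfc (hX a).1 id
    rw [cfc_id ℝ (X a) (hX a).1.isSelfAdjoint] at h
    rw [opPow, trace_cfc (hX a).1, trace_cfc (hX a).1, h, Finset.sum_sub_distrib,
      ← Finset.sum_div, Finset.sum_sub_distrib]
    rfl
  rw [hsum]
  refine (Finset.abs_sum_le_sum_abs _ _).trans_lt ?_
  calc _ ≤ ∑ _i : n, ε / (Fintype.card n + 1) := by
        refine Finset.sum_le_sum fun i _ => ?_
        have := ha _ ⟨(hX a).eigenvalues_nonneg i, (eigenvalues_le_trace (hX a) i).trans haM⟩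
        rw [Real.dist_eq] at this
        exact this.le
    _ < ε := by
        rw [Finset.sum_const, nsmul_eq_mul, Finset.card_univ, mul_div_assoc',
          div_lt_iff₀ (by positivity)]
        nlinarith

/-- The trace against functions of `K`, as a sum over the spectrum of `K`. -/
theorem exists_spectral_weights {ρ K : Matrix n n ℂ} (hρ : ρ.PosSemidef) (hK : K.PosSemidef)
    (hdom : ρ * suppProj K = ρ) : ∃ w : n → ℝ, (∀ j, 0 ≤ w j) ∧
      (∀ j, hK.1.eigenvalues j = 0 → w j = 0) ∧
      ∀ g : ℝ → ℝ, (ρ * cfc g K).trace.re = ∑ j, w j * g (hK.1.eigenvalues j) := by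
  obtain ⟨p, hp, hpt⟩ := exists_weights hρ.1 hK.1
  have h1 : ∀ g : ℝ → ℝ, (ρ * cfc g K).trace.re =
      ∑ j, (∑ i, p i j * hρ.1.eigenvalues i) * g (hK.1.eigenvalues j) := by
    intro g
    have := hpt id g
    rw [cfc_id ℝ ρ hρ.1.isSelfAdjoint] at this
    rw [this, Finset.sum_comm]
    refine Finset.sum_congr rfl fun j _ => ?_
    rw [Finset.sum_mul]
    exact Finset.sum_congr rfl fun i _ => by simp only [id]; ring
  have h0 : ∀ j, 0 ≤ ∑ i, p i j * hρ.1.eigenvalues i := fun j =>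
    Finset.sum_nonneg fun i _ => mul_nonneg (hp i j) (hρ.eigenvalues_nonneg i)
  refine ⟨_, h0, fun j hj => ?_, h1⟩
  have h2 := h1 (fun x => if x = 0 then 0 else 1)
  have h3 := h1 (fun _ => 1)
  rw [← suppProj, hdom] at h2
  rw [cfc_const_one ℝ K hK.1.isSelfAdjoint, Matrix.mul_one, h2] at h3
  have h4 : ∑ j, (∑ i, p i j * hρ.1.eigenvalues i) *
      (1 - if hK.1.eigenvalues j = 0 then 0 else 1) = 0 := by
    simp only [mul_sub, Finset.sum_sub_distrib]
    rw [h3, sub_self]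
  have h5 := (Finset.sum_eq_zero_iff_of_nonneg (fun j _ => mul_nonneg (h0 j)
    (by split_ifs <;> norm_num))).1 h4 j (Finset.mem_univ j)
  simpa [hj] using h5

theorem tendsto_opPow_nhdsNE_zero {K : Matrix n n ℂ} (hK : K.PosSemidef) :
    Tendsto (fun s => opPow K s) (𝓝[≠] 0) (𝓝 (suppProj K)) := by
  have h : ∀ i, Tendsto (fun t : ℝ => ((hK.1.eigenvalues i ^ t : ℝ) : ℂ)) (𝓝[≠] 0)
      (𝓝 ((if hK.1.eigenvalues i = 0 then 0 else 1 : ℝ) : ℂ)) := fun i => by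
    refine (Complex.continuous_ofReal.tendsto _).comp ?_
    by_cases hi : hK.1.eigenvalues i = 0
    · rw [if_pos hi, hi]
      refine tendsto_const_nhds.congr' ?_
      filter_upwards [self_mem_nhdsWithin] with t ht
      exact (Real.zero_rpow (Set.mem_compl_singleton_iff.1 ht)).symm
    · have h1 := (Real.continuousAt_const_rpow hi (b := 0)).tendsto
      rw [Real.rpow_zero] at h1
      rw [if_neg hi]
      exact h1.mono_left nhdsWithin_le_nhds
  have h2 : Tendsto (fun t : ℝ => fun i => ((hK.1.eigenvalues i ^ t : ℝ) : ℂ)) (𝓝[≠] 0)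
      (𝓝 fun i => ((if hK.1.eigenvalues i = 0 then 0 else 1 : ℝ) : ℂ)) := tendsto_pi_nhds.2 h
  have h3 : Continuous fun v : n → ℂ => (hK.1.eigenvectorUnitary : Matrix n n ℂ) * diagonal v *
      (hK.1.eigenvectorUnitary : Matrix n n ℂ)ᴴ := by fun_prop
  have h4 := (h3.tendsto _).comp h2
  simp only [opPow, suppProj, cfc_eq_diag hK.1]
  exact h4

/-- The sandwiched divergence of order `1` is Umegaki's relative entropy. -/
theorem sandwichedDiv_one {ρ K : Matrix n n ℂ} (hρ : ρ ∈ states n) (hK : K.PosSemidef)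
    (hdom : Dominated ρ K) :
    sandwichedDiv 1 ρ K = (((cfc (fun x => x * Real.log x) ρ).trace.re -
      (ρ * cfc Real.log K).trace.re : ℝ) : EReal) := by
  have hP := (dominated_iff_mul_suppProj hK.1).1 hdom
  have hP' : suppProj K * ρ = ρ := by
    have := congrArg conjTranspose hP
    have hPH : (suppProj K)ᴴ = suppProj K := isHermitian_cfc _ _
    rwa [conjTranspose_mul, hρ.1.1, hPH] at this
  set D := (cfc (fun x => x * Real.log x) ρ).trace.re - (ρ * cfc Real.log K).trace.re
  set S : ℝ → Matrix n n ℂ := fun a => opPow K ((1 - a) / (2 * a)) with hS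
  have hSH : ∀ a, (S a)ᴴ = S a := fun a => isHermitian_cfc _ _
  set X : ℝ → Matrix n n ℂ := fun a => S a * ρ * S a with hXdef
  have hX : ∀ a, (X a).PosSemidef := fun a => by
    have := hρ.1.mul_mul_conjTranspose_same (S a)
    rwa [hSH] at this
  have hexp : Tendsto (fun a : ℝ => (1 - a) / (2 * a)) (𝓝[≠] 1) (𝓝[≠] 0) := by
    refine tendsto_nhdsWithin_iff.2 ⟨?_, ?_⟩
    · have : ContinuousAt (fun a : ℝ => (1 - a) / (2 * a)) 1 :=
        ContinuousAt.div (by fun_prop) (by fun_prop) (by norm_num)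
      have h := this.tendsto.mono_left (nhdsWithin_le_nhds (s := {1}ᶜ))
      simpa using h
    · have h0 : ∀ᶠ a : ℝ in 𝓝[≠] 1, a ≠ 0 :=
        eventually_nhdsWithin_of_eventually_nhds (isOpen_ne.mem_nhds one_ne_zero)
      filter_upwards [h0, self_mem_nhdsWithin] with a ha ha1
      exact div_ne_zero (sub_ne_zero.2 (Ne.symm ha1)) (by simpa using ha)
  have hXlim : Tendsto X (𝓝[≠] 1) (𝓝 ρ) := by
    have h1 : Tendsto S (𝓝[≠] 1) (𝓝 (suppProj K)) := (tendsto_opPow_nhdsNE_zero hK).comp hexp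
    have h2 := (h1.mul_const ρ).mul h1
    rwa [hP', hP] at h2
  have hA := tendsto_trace_opPow_sub_div hX hρ.1 hXlim
  obtain ⟨w, -, hw0, hw⟩ := exists_spectral_weights hρ.1 hK hP
  -- The trace of `X a`, as a differentiable function of `a`.
  set H : ℝ → ℝ := fun a => ∑ j, w j * hK.1.eigenvalues j ^ (1 / a - 1) with hH
  have htrX : ∀ a : ℝ, a ≠ 0 → a ≠ 1 → (X a).trace.re = H a := by
    intro a ha ha1
    have hne : 1 / a - 1 ≠ 0 := by
      rw [sub_ne_zero, Ne, div_eq_iff ha, one_mul]; exact ha1.symm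
    have h1 : (X a).trace = (ρ * opPow K (1 / a - 1)).trace := by
      rw [hXdef]
      simp only
      rw [trace_mul_cycle, trace_mul_comm, hS]
      simp only
      rw [show (1 - a) / (2 * a) = (1 / a - 1) / 2 by field_simp,
        opPow_mul_opPow_half hK hne]
    rw [h1, opPow, hw]
  have hH1 : H 1 = 1 := by
    have h1 := hw (fun _ => 1)
    rw [cfc_const_one ℝ K hK.1.isSelfAdjoint, Matrix.mul_one, hρ.2] at h1
    simp only [hH]
    norm_num
    simpa using h1.symm
  have hHderiv : HasDerivAt H (-(ρ * cfc Real.log K).trace.re) 1 := by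
    rw [hw, ← Finset.sum_neg_distrib]
    refine HasDerivAt.fun_sum fun j _ => ?_
    by_cases hj : hK.1.eigenvalues j = 0
    · rw [hw0 j hj]
      simpa using hasDerivAt_const (1 : ℝ) (0 : ℝ)
    · have hpos : 0 < hK.1.eigenvalues j := (hK.eigenvalues_nonneg j).lt_of_ne' hj
      have h1 : HasDerivAt (fun a : ℝ => 1 / a - 1) (-1) 1 := by
        have := (hasDerivAt_inv (one_ne_zero (α := ℝ))).sub_const 1
        simpa [one_div] using this
      have h2 := (h1.const_rpow hpos).const_mul (w j)
      exact h2.congr_deriv (by norm_num)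
  set f : ℝ → ℝ := fun a => (opPow (X a) a).trace.re with hf
  have hX1 : X 1 = ρ := by
    have : S 1 = 1 := by
      simp only [hS, opPow]
      norm_num
      exact cfc_const_one ℝ K hK.1.isSelfAdjoint
    simp [hXdef, this]
  have hf1 : f 1 = 1 := by
    simp only [hf, hX1, opPow, Real.rpow_one]
    rw [cfc_id' ℝ ρ hρ.1.1.isSelfAdjoint, hρ.2, Complex.one_re]
  have hfderiv : HasDerivAt f D 1 := by
    rw [hasDerivAt_iff_tendsto_slope] at hHderiv ⊢
    have h1 := hA.add hHderiv
    rw [← sub_eq_add_neg] at h1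
    refine h1.congr' ?_
    have h0 : ∀ᶠ a : ℝ in 𝓝[≠] 1, a ≠ 0 :=
      eventually_nhdsWithin_of_eventually_nhds (isOpen_ne.mem_nhds one_ne_zero)
    filter_upwards [h0, self_mem_nhdsWithin] with a ha ha1
    rw [slope_def_field, slope_def_field, hf1, hH1, htrX a ha ha1, ← add_div]
    congr 1
    simp only [hf]
    ring
  have hlog := hfderiv.log (by rw [hf1]; exact one_ne_zero)
  rw [hf1, div_one, hasDerivAt_iff_tendsto_slope] at hlog
  have hexpr : Tendsto (fun a : ℝ => sandwichedExpr a ρ K) (𝓝[≠] 1) (𝓝 D) := by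
    refine hlog.congr fun a => ?_
    rw [slope_def_field, hf1, Real.log_one, sub_zero, sandwichedExpr, one_div_mul_eq_div]
  have hreal : Tendsto ENNReal.toReal (𝓝[≠] 1) (𝓝[≠] 1) := by
    refine tendsto_nhdsWithin_iff.2 ⟨?_, ?_⟩
    · have := (ENNReal.tendsto_toReal ENNReal.one_ne_top).mono_left
        (nhdsWithin_le_nhds (s := {1}ᶜ))
      simpa using this
    · filter_upwards [self_mem_nhdsWithin] with a ha
      intro h
      exact ha ((ENNReal.toReal_eq_one_iff a).1 h)
  have hlim : Tendsto (fun a : ℝ≥0∞ => sandwichedExpr a.toReal ρ K) (𝓝[≠] 1) (𝓝 D) :=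
    hexpr.comp hreal
  rw [sandwichedDiv, if_pos hdom, if_pos (by simp), hlim.limUnder_eq]

end OrderOne


/-! ### Nonnegativity of the relative entropy -/

section RelativeEntropy

variable {n : Type*} [Fintype n] [DecidableEq n]

/-- Nonnegativity of the relative entropy of two states. -/
theorem trace_mul_log_le {ρ σ : Matrix n n ℂ} (hρ : ρ ∈ states n) (hσ : σ ∈ states n)
    (hdom : ρ * suppProj σ = ρ) :
    (ρ * cfc Real.log σ).trace.re ≤ (cfc (fun x => x * Real.log x) ρ).trace.re := by
  have hρH := hρ.1.1
  have hσH := hσ.1.1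
  -- The scalar inequality `x log y - x log x ≤ y - x` fails at `y = 0`, where `log 0 = 0`; by
  -- domination, such `y` are paired with weight zero to every eigenvalue `x ≠ 0`.
  obtain ⟨p, hp, hpt⟩ := exists_weights hρH hσH
  have hzero : ∀ i j, hσH.eigenvalues j = 0 → p i j * hρH.eigenvalues i = 0 := by
    have h2 := hpt id (fun x => if x = 0 then 0 else 1)
    have h3 := hpt id (fun _ => 1)
    rw [cfc_id ℝ ρ hρH.isSelfAdjoint, ← suppProj, hdom] at h2
    rw [cfc_id ℝ ρ hρH.isSelfAdjoint, cfc_const_one ℝ σ hσH.isSelfAdjoint, Matrix.mul_one,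
      h2] at h3
    have h4 : ∑ i, ∑ j, p i j * hρH.eigenvalues i *
        (1 - if hσH.eigenvalues j = 0 then 0 else 1) = 0 := by
      simp only [mul_sub, Finset.sum_sub_distrib]
      rw [sub_eq_zero]
      simp only [id] at h3
      simp only [mul_assoc]
      exact h3.symm
    have hnn : ∀ i j, 0 ≤ p i j * hρH.eigenvalues i *
        (1 - if hσH.eigenvalues j = 0 then 0 else 1) := fun i j =>
      mul_nonneg (mul_nonneg (hp i j) (hρ.1.eigenvalues_nonneg i)) (by split_ifs <;> norm_num)
    intro i j hj
    have h5 := (Finset.sum_eq_zero_iff_of_nonneg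
      (fun i _ => Finset.sum_nonneg fun j _ => hnn i j)).1 h4 i (Finset.mem_univ i)
    have h6 := (Finset.sum_eq_zero_iff_of_nonneg (fun j _ => hnn i j)).1 h5 j (Finset.mem_univ j)
    simpa [hj] using h6
  have e1 := hpt id Real.log
  have e2 := hpt (fun x => x * Real.log x) (fun _ => 1)
  have e3 := hpt id (fun _ => 1)
  have e4 := hpt (fun _ => 1) id
  rw [cfc_id ℝ ρ hρH.isSelfAdjoint] at e1 e3
  rw [cfc_const_one ℝ σ hσH.isSelfAdjoint, Matrix.mul_one] at e2 e3
  rw [cfc_const_one ℝ ρ hρH.isSelfAdjoint, Matrix.one_mul, cfc_id ℝ σ hσH.isSelfAdjoint] at e4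
  have hsum : (ρ * cfc Real.log σ).trace.re + ρ.trace.re ≤
      (cfc (fun x => x * Real.log x) ρ).trace.re + σ.trace.re := by
    rw [e1, e2, e3, e4]
    simp only [← Finset.sum_add_distrib]
    refine Finset.sum_le_sum fun i _ => Finset.sum_le_sum fun j _ => ?_
    simp only [id, mul_one, one_mul]
    have hx := hρ.1.eigenvalues_nonneg i
    have hy := hσ.1.eigenvalues_nonneg j
    set x := hρH.eigenvalues i
    set y := hσH.eigenvalues j
    rcases hy.eq_or_lt with h | h
    · have h0 := hzero i j h.symm
      rw [← mul_assoc, ← mul_assoc, h0]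
      have := mul_nonneg (hp i j) hy
      linarith
    · rw [← mul_add, ← mul_add]
      refine mul_le_mul_of_nonneg_left ?_ (hp i j)
      rcases hx.eq_or_lt with h' | h'
      · rw [← h']; simp only [zero_mul, zero_add]; exact hy
      · have h7 := Real.log_le_sub_one_of_pos (div_pos h h')
        rw [Real.log_div h.ne' h'.ne'] at h7
        have h8 := mul_le_mul_of_nonneg_left h7 hx
        have h9 : x * (y / x - 1) = y - x := by field_simp
        linarith
  rw [hρ.2, hσ.2] at hsum
  linarith

end RelativeEntropy

/-! ### The duality -/

section OrderOneDuality

variable {A B C : Type*} [Fintype A] [DecidableEq A] [Fintype B] [DecidableEq B] [Fintype C]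
  [DecidableEq C]

/-- The logarithm of a product, for all reals: both sides vanish if `x` or `y` does, since
`log 0 = 0`. -/
theorem log_mul_eq_of_log_zero (x y : ℝ) : Real.log (x * y) =
    Real.log x * (if y = 0 then 0 else 1) + (if x = 0 then 0 else 1) * Real.log y := by
  by_cases hx : x = 0
  · simp [hx]
  by_cases hy : y = 0
  · simp [hy]
  simp [hx, hy, Real.log_mul hx hy]

theorem trace_ampLeft_mul (ψ : A → B → C → ℂ) (M : Matrix A A ℂ) :
    (amp ψ * (amp ψ)ᴴ * (M ⊗ₖ (1 : Matrix B B ℂ))).trace =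
      (ampLeft ψ * (ampLeft ψ)ᴴ * M).trace := by
  rw [trace_mul_comm (amp ψ * (amp ψ)ᴴ), ← Matrix.mul_assoc, trace_mul_comm _ M,
    ← Matrix.mul_assoc]
  simp only [trace, diag_apply, Matrix.mul_apply (N := (amp ψ)ᴴ),
    Matrix.mul_apply (N := (ampLeft ψ)ᴴ), Fintype.sum_prod_type, kronecker_one_mul_amp_apply]
  refine Finset.sum_congr rfl fun a _ => Finset.sum_congr rfl fun b _ =>
    Finset.sum_congr rfl fun c _ => rfl

theorem trace_ampMid_mul (ψ : A → B → C → ℂ) (M : Matrix B B ℂ) :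
    (amp ψ * (amp ψ)ᴴ * ((1 : Matrix A A ℂ) ⊗ₖ M)).trace =
      (ampMid ψ * (ampMid ψ)ᴴ * M).trace := by
  rw [trace_mul_comm (amp ψ * (amp ψ)ᴴ), ← Matrix.mul_assoc, trace_mul_comm _ M,
    ← Matrix.mul_assoc]
  simp only [trace, diag_apply, Matrix.mul_apply (N := (amp ψ)ᴴ),
    Matrix.mul_apply (N := (ampMid ψ)ᴴ), Fintype.sum_prod_type, one_kronecker_mul_amp_apply]
  rw [Finset.sum_comm]
  refine Finset.sum_congr rfl fun a _ => Finset.sum_congr rfl fun b _ =>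
    Finset.sum_congr rfl fun c _ => rfl

theorem ampMid_mem_states {ψ : A → B → C → ℂ} (hψ : (amp ψ * (amp ψ)ᴴ).trace = 1) :
    ampMid ψ * (ampMid ψ)ᴴ ∈ states B := by
  refine ⟨posSemidef_self_mul_conjTranspose _, ?_⟩
  have := trace_ampMid_mul ψ 1
  rw [one_kronecker_one, Matrix.mul_one, Matrix.mul_one, hψ] at this
  exact this.symm

/-- The entropy of a marginal of a pure state is that of the complementary marginal. -/
theorem trace_cfc_amp_exch (ψ : A → B → C → ℂ) {f : ℝ → ℝ} (hf : f 0 = 0) :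
    (cfc f (amp (exch ψ) * (amp (exch ψ))ᴴ)).trace =
      (cfc f (ampMid ψ * (ampMid ψ)ᴴ)).trace := by
  have h : (amp (exch ψ))ᴴ * amp (exch ψ) = (ampMid ψ * (ampMid ψ)ᴴ)ᵀ := by
    ext b b'
    simp [Matrix.mul_apply, amp, exch, ampMid, mul_comm]
  rw [trace_cfc_mul_conjTranspose _ hf, h,
    cfc_transpose (isHermitian_mul_conjTranspose_self _), trace_transpose]

/-- The divergence of order `1` relative to a product operator. -/
theorem sandwichedDiv_one_amp {ψ : A → B → C → ℂ} (hψ : (amp ψ * (amp ψ)ᴴ).trace = 1)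
    {τ : Matrix A A ℂ} {σ : Matrix B B ℂ} (hτ : τ.PosSemidef) (hσ : σ.PosSemidef)
    (hA : suppProj τ * ampLeft ψ = ampLeft ψ) (hB : suppProj σ * ampMid ψ = ampMid ψ) :
    sandwichedDiv 1 (amp ψ * (amp ψ)ᴴ) (τ ⊗ₖ σ) =
      (((cfc (fun x => x * Real.log x) (amp ψ * (amp ψ)ᴴ)).trace.re -
        (ampLeft ψ * (ampLeft ψ)ᴴ * cfc Real.log τ).trace.re -
        (ampMid ψ * (ampMid ψ)ᴴ * cfc Real.log σ).trace.re : ℝ) : EReal) := by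
  rw [sandwichedDiv_one ⟨posSemidef_self_mul_conjTranspose _, hψ⟩ (hτ.kronecker hσ)
    ((dominated_amp_iff hτ.1 hσ.1 hA).2 hB)]
  congr 1
  rw [sub_sub]
  congr 1
  rw [cfc_kronecker_add hτ.1 hσ.1 (g₁ := Real.log) (h₁ := fun y => if y = 0 then 0 else 1)
    (g₂ := fun x => if x = 0 then 0 else 1) (h₂ := Real.log)
    (fun i j => log_mul_eq_of_log_zero _ _), ← suppProj, ← suppProj]
  have h1 := one_kronecker_mul_amp (A := A).2 hB
  have h2 := kronecker_one_mul_amp (B := B).2 hA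
  have e1 : cfc Real.log τ ⊗ₖ suppProj σ =
      ((1 : Matrix A A ℂ) ⊗ₖ suppProj σ) * (cfc Real.log τ ⊗ₖ (1 : Matrix B B ℂ)) *
        ((1 : Matrix A A ℂ) ⊗ₖ suppProj σ) := by
    rw [← mul_kronecker_mul, ← mul_kronecker_mul]
    simp [suppProj_mul_self hσ.1]
  have e2 : suppProj τ ⊗ₖ cfc Real.log σ =
      (suppProj τ ⊗ₖ (1 : Matrix B B ℂ)) * ((1 : Matrix A A ℂ) ⊗ₖ cfc Real.log σ) *
        (suppProj τ ⊗ₖ (1 : Matrix B B ℂ)) := by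
    rw [← mul_kronecker_mul, ← mul_kronecker_mul]
    simp [suppProj_mul_self hτ.1]
  have key : ∀ {P M : Matrix (A × B) (A × B) ℂ}, Pᴴ = P → P * amp ψ = amp ψ →
      (amp ψ * (amp ψ)ᴴ * (P * M * P)).trace = (amp ψ * (amp ψ)ᴴ * M).trace := by
    intro P M hP hPψ
    have hPψ' : (amp ψ)ᴴ * P = (amp ψ)ᴴ := by
      have := congrArg conjTranspose hPψ
      rwa [conjTranspose_mul, hP] at this
    rw [show amp ψ * (amp ψ)ᴴ * (P * M * P) = amp ψ * ((amp ψ)ᴴ * P) * M * P by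
      simp only [Matrix.mul_assoc], hPψ', trace_mul_comm, ← Matrix.mul_assoc, ← Matrix.mul_assoc,
      hPψ]
  have hPσ : (suppProj σ)ᴴ = suppProj σ := isHermitian_cfc _ _
  have hPτ : (suppProj τ)ᴴ = suppProj τ := isHermitian_cfc _ _
  rw [e1, e2, Matrix.mul_add, trace_add, Complex.add_re,
    key (by rw [conjTranspose_kronecker, conjTranspose_one, hPσ]) h1,
    key (by rw [conjTranspose_kronecker, conjTranspose_one, hPτ]) h2,
    trace_ampLeft_mul, trace_ampMid_mul]

/-- At order `1` the infimum is attained at the marginal. -/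
theorem sandwichedInfo_one_amp {ψ : A → B → C → ℂ} (hψ : (amp ψ * (amp ψ)ᴴ).trace = 1)
    {τ : Matrix A A ℂ} (hτ : τ.PosSemidef) (hA : suppProj τ * ampLeft ψ = ampLeft ψ) :
    sandwichedInfo 1 (amp ψ * (amp ψ)ᴴ) τ =
      (((cfc (fun x => x * Real.log x) (amp ψ * (amp ψ)ᴴ)).trace.re -
        (ampLeft ψ * (ampLeft ψ)ᴴ * cfc Real.log τ).trace.re -
        (cfc (fun x => x * Real.log x) (ampMid ψ * (ampMid ψ)ᴴ)).trace.re : ℝ) : EReal) := by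
  have hρB := ampMid_mem_states hψ
  apply le_antisymm
  · have hdom : suppProj (ampMid ψ * (ampMid ψ)ᴴ) * ampMid ψ = ampMid ψ :=
      (dominated_mul_conjTranspose_iff hρB.1.1).1 le_rfl
    refine (iInf₂_le _ hρB).trans (le_of_eq ?_)
    rw [sandwichedDiv_one_amp hψ hτ hρB.1 hA hdom, trace_mul_cfc_self hρB.1.1, trace_cfc hρB.1.1]
  · refine le_iInf₂ fun σ hσ => ?_
    by_cases hB : suppProj σ * ampMid ψ = ampMid ψ
    · rw [sandwichedDiv_one_amp hψ hτ hσ.1 hA hB, EReal.coe_le_coe_iff]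
      have := trace_mul_log_le hρB hσ ((dominated_iff_mul_suppProj hσ.1.1).1
        ((dominated_mul_conjTranspose_iff hσ.1.1).2 hB))
      linarith
    · rw [sandwichedDiv_amp_eq_top hτ.1 hσ.1.1 hA hB]
      exact le_top

theorem sandwichedInfo_duality_one {ψ : A → B → C → ℂ} (hψ : (amp ψ * (amp ψ)ᴴ).trace = 1)
    {τ : Matrix A A ℂ} (hτ : τ.PosSemidef) (hA : suppProj τ * ampLeft ψ = ampLeft ψ) :
    sandwichedInfo 1 (amp ψ * (amp ψ)ᴴ) τ =
      -sandwichedInfo 1 (amp (exch ψ) * (amp (exch ψ))ᴴ) (suppInv τ) := by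
  have hψ' : (amp (exch ψ) * (amp (exch ψ))ᴴ).trace = 1 := by
    have h1 := trace_cfc_amp_exch ψ (f := id) rfl
    rw [cfc_id ℝ _ (isHermitian_mul_conjTranspose_self _).isSelfAdjoint,
      cfc_id ℝ _ (isHermitian_mul_conjTranspose_self _).isSelfAdjoint] at h1
    rw [h1]
    exact (ampMid_mem_states hψ).2
  have hA' : suppProj (suppInv τ) * ampLeft (exch ψ) = ampLeft (exch ψ) := by
    rw [suppProj_suppInv hτ.1]
    exact ampLeft_exch_iff.2 hA
  have hlog : cfc Real.log (suppInv τ) = -cfc Real.log τ := by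
    rw [suppInv, cfc_comp_cfc hτ.1, ← cfc_neg]
    simp only [Real.log_inv]
  have hleft : ampLeft (exch ψ) * (ampLeft (exch ψ))ᴴ = ampLeft ψ * (ampLeft ψ)ᴴ := by
    ext a a'
    simp only [Matrix.mul_apply, ampLeft, exch, of_apply, conjTranspose_apply,
      Fintype.sum_prod_type]
    exact Finset.sum_comm
  have e1 := trace_cfc_amp_exch ψ (f := fun x => x * Real.log x) (zero_mul _)
  have e2 := trace_cfc_amp_exch (exch ψ) (f := fun x => x * Real.log x) (zero_mul _)
  rw [show exch (exch ψ) = ψ from rfl] at e2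
  rw [sandwichedInfo_one_amp hψ hτ hA, sandwichedInfo_one_amp hψ' (posSemidef_suppInv hτ) hA',
    ← EReal.coe_neg, EReal.coe_eq_coe_iff, hlog, hleft, e1, e2, Matrix.mul_neg, trace_neg,
    Complex.neg_re]
  ring

/-- The duality for `1 < α ≤ ∞`; the relation between the orders is stated in real numbers, with
`∞.toReal = 0`. -/
theorem sandwichedInfo_duality_gt_one {ψ : A → B → C → ℂ} (hψ : amp ψ ≠ 0)
    {τ : Matrix A A ℂ} (hτ : τ.PosSemidef) (hA : suppProj τ * ampLeft ψ = ampLeft ψ)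
    {α β : ℝ≥0∞} (hα : 1 < α) (hαβ : (α.toReal)⁻¹ + (β.toReal)⁻¹ = 2) :
    sandwichedInfo α (amp ψ * (amp ψ)ᴴ) τ =
      -sandwichedInfo β (amp (exch ψ) * (amp (exch ψ))ᴴ) (suppInv τ) := by
  -- For `α = ∞` this reads `γ = 1`, since `∞.toReal = 0`.
  set γ := 1 - (α.toReal)⁻¹ with hγdef
  have hα1 : α = ∞ ∨ 1 < α.toReal := by
    rcases eq_or_ne α ∞ with h | h
    · exact Or.inl h
    · right
      have := (ENNReal.toReal_lt_toReal ENNReal.one_ne_top h).2 hα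
      simpa using this
  have hγ : 0 < γ := by
    rcases hα1 with h | h
    · simp [hγdef, h]
    · have := inv_lt_one_of_one_lt₀ h
      linarith
  have hγ1 : γ ≤ 1 := by
    have : 0 ≤ (α.toReal)⁻¹ := by positivity
    linarith
  have hβ : β.toReal = 1 / (1 + γ) := by
    have : (β.toReal)⁻¹ = 1 + γ := by linarith
    rw [one_div, ← this, inv_inv]
  have hA' : suppProj (suppInv τ) * ampLeft (exch ψ) = ampLeft (exch ψ) := by
    rw [suppProj_suppInv hτ.1]
    exact ampLeft_exch_iff.2 hA
  have hψ' : amp (exch ψ) ≠ 0 := by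
    intro h
    refine hψ ?_
    ext ⟨a, b⟩ c
    exact congrFun (congrFun h (a, c)) b
  refine sandwichedInfo_duality_of_variational hψ (T := opPow τ (-γ)) (posSemidef_opPow hτ _)
    hγ hγ1 ?_ ?_ ?_ ?_
  · intro σ hσ hB
    rcases hα1 with h | h
    · have h1 : γ = 1 := by simp [hγdef, h]
      rw [h1, h]
      exact sandwichedDiv_variational_top hψ hτ hσ.1 hA hB
    · refine sandwichedDiv_variational_gt_one hψ hτ hσ.1 hA hB hγ ?_ ?_
      · have : 0 < (α.toReal)⁻¹ := by positivity
        linarith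
      · rw [hγdef, sub_sub_cancel, one_div, inv_inv]
  · exact fun σ hσ hB => sandwichedDiv_amp_eq_top hτ.1 hσ.1.1 hA hB α
  · intro ω hω hC
    rw [← opPow_suppInv hτ γ]
    exact sandwichedDiv_variational_lt_one hψ' (posSemidef_suppInv hτ) hω.1 hA' hC hγ hβ
  · exact fun ω hω hC =>
      sandwichedDiv_amp_eq_top (posSemidef_suppInv hτ).1 hω.1.1 hA' hC β

end OrderOneDuality

end QInfo

theorem mainTheorem8 {A B C : Type*}
    [Fintype A] [DecidableEq A] [Fintype B] [DecidableEq B] [Fintype C] [DecidableEq C]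
    (ρAB : Matrix (A × B) (A × B) ℂ) (hρ : ρAB ∈ QInfo.states (A × B))
    (τ : Matrix A A ℂ) (hτ : τ.PosSemidef)
    (hsupp : QInfo.Dominated (QInfo.traceRight ρAB) τ)
    (α β : ℝ≥0∞) (hα : 1 / 2 ≤ α) (hβ : 1 / 2 ≤ β) (hαβ : 1 / α + 1 / β = 2)
    (ρABC : Matrix ((A × B) × C) ((A × B) × C) ℂ) (hpur : QInfo.IsPurification ρABC ρAB) :
    QInfo.sandwichedInfo α ρAB τ =
      - QInfo.sandwichedInfo β (QInfo.traceMiddle ρABC) (QInfo.suppInv τ) := by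
  obtain ⟨φ, hφ⟩ := hpur.pure
  set ψ : A → B → C → ℂ := fun a b c => φ ((a, b), c)
  have hAB : ρAB = QInfo.amp ψ * (QInfo.amp ψ)ᴴ := by
    rw [← hpur.marginal, hφ]
    ext p q
    simp [QInfo.traceRight, QInfo.amp, Matrix.mul_apply, vecMulVec_apply, ψ]
  have hAC : QInfo.traceMiddle ρABC = QInfo.amp (QInfo.exch ψ) * (QInfo.amp (QInfo.exch ψ))ᴴ := by
    rw [hφ]
    ext p q
    simp [QInfo.traceMiddle, QInfo.amp, QInfo.exch, Matrix.mul_apply, vecMulVec_apply, ψ]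
  have htr : (QInfo.amp ψ * (QInfo.amp ψ)ᴴ).trace = 1 := hAB ▸ hρ.2
  have hψ : QInfo.amp ψ ≠ 0 := by
    intro h
    rw [h, Matrix.zero_mul, trace_zero] at htr
    exact zero_ne_one htr
  have hA : QInfo.suppProj τ * QInfo.ampLeft ψ = QInfo.ampLeft ψ := by
    rw [hAB, QInfo.traceRight_amp] at hsupp
    exact (QInfo.dominated_mul_conjTranspose_iff hτ.1).1 hsupp
  have hα0 : α ≠ 0 := by rintro rfl; simp at hα
  have hβ0 : β ≠ 0 := by rintro rfl; simp at hβ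
  have hreal : (α.toReal)⁻¹ + (β.toReal)⁻¹ = 2 := by
    have h := congrArg ENNReal.toReal hαβ
    rw [one_div, one_div, ENNReal.toReal_add (ENNReal.inv_ne_top.2 hα0)
      (ENNReal.inv_ne_top.2 hβ0), ENNReal.toReal_inv, ENNReal.toReal_inv] at h
    simpa using h
  rw [hAC, hAB]
  rcases lt_trichotomy α 1 with h | rfl | h
  · have hβ1 : 1 < β := by
      by_contra! hle
      have h1 : (1 : ℝ) ≤ (β.toReal)⁻¹ := by
        refine (one_le_inv₀ (ENNReal.toReal_pos hβ0 (ne_top_of_le_ne_top ENNReal.one_ne_top hle))).2 ?_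
        simpa using ENNReal.toReal_mono ENNReal.one_ne_top hle
      have h2 : (1 : ℝ) < (α.toReal)⁻¹ := by
        refine (one_lt_inv₀ (ENNReal.toReal_pos hα0 h.ne_top)).2 ?_
        simpa using (ENNReal.toReal_lt_toReal h.ne_top ENNReal.one_ne_top).2 h
      linarith
    have hA' : QInfo.suppProj (QInfo.suppInv τ) * QInfo.ampLeft (QInfo.exch ψ) =
        QInfo.ampLeft (QInfo.exch ψ) := by
      rw [QInfo.suppProj_suppInv hτ.1]
      exact QInfo.ampLeft_exch_iff.2 hA
    have hψ' : QInfo.amp (QInfo.exch ψ) ≠ 0 := by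
      intro h
      refine hψ ?_
      ext ⟨a, b⟩ c
      exact congrFun (congrFun h (a, c)) b
    have key := QInfo.sandwichedInfo_duality_gt_one hψ' (QInfo.posSemidef_suppInv hτ) hA' hβ1
      (by rw [add_comm]; exact hreal)
    rw [key, QInfo.suppInv_suppInv hτ.1, neg_neg]
    rfl
  · have hβ1 : β = 1 := by
      rw [← ENNReal.toReal_eq_one_iff]
      have h1 : (β.toReal)⁻¹ = 1 := by
        rw [ENNReal.toReal_one, inv_one] at hreal
        linarith
      exact inv_eq_one.1 h1
    rw [hβ1]
    exact QInfo.sandwichedInfo_duality_one htr hτ hA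
  · exact QInfo.sandwichedInfo_duality_gt_one hψ hτ hA h hreal
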